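/- Let $d,n\ge 1$ and let two parties A and B share $n$ parallel links, the $i$-th link being the bipartite pure state $|\lambda_i\rangle=\sum_{j=1}^{d}\sqrt{\lambda_{i,j}}\,|jj\rangle\in\mathbb C^d\otimes\mathbb C^d$ with Schmidt numbers $\lambda_{i,j}\ge 0$, $\sum_{j}\lambda_{i,j}=1$ (a simple parallel quantum network). For $m\ge d$ and $x\in\mathbb R_+^m$ with decreasing rearrangement $x^{\downarrow}$, define $\mathcal P(x)=(\chi_1,\dots,\chi_d)$ recursively by $s_1=\sum_{j=1}^m x_j$, $\chi_l=\max\{x^{\downarrow}_l,\;s_l/(d+1-l)\}$, $s_{l+1}=s_l-\chi_l$ for $l=1,\dots,d$. For a probability vector $\lambda\in\mathbb R_+^d$ and $1\le k\le d$ let $$C_k(\lambda)=\left[\frac{S_k(\lambda)}{S_k(1/d,\dots,1/d)}\right]^{1/k}$$ be the $k$-concurrence, $S_k$ being the $k$-th elementary symmetric polynomial; the $k$-concurrence of a normalized pure state of $\mathbb C^d\otimes\mathbb C^d$ is that of its vector of Schmidt numbers (squared singular values of its coefficient matrix). A (finite-round) LOCC protocol between A and B consists of finitely many rounds in each of which one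 party performs a local quantum measurement with finitely many outcomes (Kraus operators $M_i$ with $\sum_i M_i^\dagger M_i=1$, possibly changing the local dimension) and communicates the result, on which all later steps may depend; at the end some function of the results is kept as the outcome $\alpha$. We say that $|\lambda_1\rangle\otimes\cdots\otimes|\lambda_n\rangle$ is converted by LOCC into the ensemble $\{p_\alpha,|\Phi_\alpha\rangle\}$ of normalized pure states of $\mathbb C^d\otimes\mathbb C^d$ if some LOCC protocol applied to it has, for each outcome $\alpha$, the unnormalized final state $p_\alpha|\Phi_\alpha\rangle\langle\Phi_\alpha|$. The average $k$-concurrence of the ensemble is $\sum_\alpha p_\alpha C_k(\Phi_\alpha)$. Put $\chi=\mathcal P(\lambda_1\otimes\cdots\otimes\lambda_n)\in\mathbb R_+^d$ ($\otimes$ denoting the Kronecker product of vectors). Then: 1. (the parallel rule is deterministically implementable) $|\lambda_1\rangle\otimes\cdots\otimes|\lambda_n\rangle$ is converted by LOCC with probability $1$ into the state $\sum_{j=1}^d\sqrt{\chi_j}\,|jj\rangle$; 2. (optimality) for every $k=1,\dots,d$, the maximum of the average $k$-concurrence $\sum_\alpha p_\alpha C_k(\Phi_\alpha)$ over all finite ensembles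 $\{p_\alpha,|\Phi_\alpha\rangle\}$ of pure states of $\mathbb C^d\otimes\mathbb C^d$ into which $|\lambda_1\rangle\otimes\cdots\otimes|\lambda_n\rangle$ can be converted by LOCC exists and equals $C_k(\chi)$. In particular $\sum_\alpha p_\alpha C_k(\Phi_\alpha)\le C_k(\mathcal P(\lambda_1\otimes\cdots\otimes\lambda_n))$ for every such ensemble. -/

import Mathlib

open Matrix

noncomputable section

namespace QNet

/-- The state `∑ⱼ √λⱼ |jj⟩` of a link with Schmidt numbers `lam`, in matrix form: a bipartite pure
state `∑ Ψ μ ν |μ⟩_A |ν⟩_B` is identified with the matrix `Ψ`. -/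
def linkState {d : ℕ} (lam : Fin d → ℝ) : Matrix (Fin d) (Fin d) ℂ :=
  Matrix.diagonal fun j => ((Real.sqrt (lam j) : ℝ) : ℂ)

/-- The joint state `|λ₁⟩ ⊗ ⋯ ⊗ |λₙ⟩` of `n` parallel links shared by A and B.  The local space of
either party is `(ℂ^d)^{⊗ n}`, whose product basis `Fin n → Fin d` is enumerated by
`Fin (d ^ n)`. -/
def parallelState {d n : ℕ} (lam : Fin n → Fin d → ℝ) :
    Matrix (Fin (d ^ n)) (Fin (d ^ n)) ℂ :=
  Matrix.of fun x y =>
    ∏ i, linkState (lam i) (finFunctionFinEquiv.symm x i) (finFunctionFinEquiv.symm y i)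

/-- The Kronecker product `λ₁ ⊗ ⋯ ⊗ λₙ` of vectors. -/
def kronVec {d n : ℕ} (lam : Fin n → Fin d → ℝ) : Fin (d ^ n) → ℝ :=
  fun x => ∏ i, lam i (finFunctionFinEquiv.symm x i)

/-! ### The purification function -/

/-- The decreasing rearrangement `x↓` (indexed from `0`, and `0` beyond the length of `x`). -/
def sortDesc {m : ℕ} (x : Fin m → ℝ) (l : ℕ) : ℝ :=
  if h : l < m then x (Tuple.sort (fun i => -x i) ⟨l, h⟩) else 0

/-- The value of the variable `s` before step `l` (counted from `0`) of the algorithm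
`s ← ∑ x; for l: χ_l ← max (x↓_l) (s / (d - l)); s ← s - χ_l`. -/
def purifyRest (d : ℕ) {m : ℕ} (x : Fin m → ℝ) : ℕ → ℝ
  | 0 => ∑ i, x i
  | l + 1 => purifyRest d x l - max (sortDesc x l) (purifyRest d x l / ((d : ℝ) - (l : ℝ)))

/-- The purification function `𝒫 : ℝ₊^m → ℝ₊^d` (for `m ≥ d`). -/
def purify (d : ℕ) {m : ℕ} (x : Fin m → ℝ) : Fin d → ℝ :=
  fun l => max (sortDesc x l) (purifyRest d x l / ((d : ℝ) - ((l : ℕ) : ℝ)))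

/-! ### Concurrence monotones -/

/-- The `k`-th elementary symmetric polynomial evaluated at `x`. -/
def elemSymm {d : ℕ} (k : ℕ) (x : Fin d → ℝ) : ℝ :=
  MvPolynomial.eval x (MvPolynomial.esymm (Fin d) ℝ k)

/-- The `k`-concurrence `C_k(λ) = [S_k(λ) / S_k(1/d, …, 1/d)]^{1/k}`. -/
def concurrence {d : ℕ} (k : ℕ) (lam : Fin d → ℝ) : ℝ :=
  (elemSymm k lam / elemSymm k (fun _ : Fin d => (1 : ℝ) / (d : ℝ))) ^ ((1 : ℝ) / (k : ℝ))

/-- The Schmidt numbers of a bipartite pure state: the squared singular values of its matrix `Φ`,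
i.e. the eigenvalues of the reduced density matrix `Φ Φᴴ`, with multiplicity. -/
def schmidtNumbers {d : ℕ} (Φ : Matrix (Fin d) (Fin d) ℂ) : Fin d → ℝ :=
  (Matrix.isHermitian_mul_conjTranspose_self Φ).eigenvalues

/-! ### LOCC protocols -/

/-- The (possibly unnormalized) density matrix `|Ψ⟩⟨Ψ|` of a bipartite vector. -/
def pureDensity {a b : ℕ} (Ψ : Matrix (Fin a) (Fin b) ℂ) :
    Matrix (Fin a × Fin b) (Fin a × Fin b) ℂ :=
  Matrix.of fun x y => Ψ x.1 x.2 * star (Ψ y.1 y.2)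

/-- Two-party LOCC protocols acting on `ℂ^a ⊗ ℂ^b`, returning a state of `ℂ^d ⊗ ℂ^d` together with a
classical outcome in `Fin N`.  In each round one of the parties performs a complete quantum
measurement (Kraus operators `M i`, possibly changing the local dimension, so local ancillas and
partial traces are covered) and announces the result, on which the rest of the protocol may depend.
At the end an outcome `α` is declared; this is the only classical information which is kept. -/
inductive LOCC (d N : ℕ) : ℕ → ℕ → Type
  | done (α : Fin N) : LOCC d N d d
  | alice {a b r : ℕ} (a' : Fin r → ℕ) (M : (i : Fin r) → Matrix (Fin (a' i)) (Fin a) ℂ)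
      (complete : ∑ i, (M i)ᴴ * M i = 1) (next : (i : Fin r) → LOCC d N (a' i) b) : LOCC d N a b
  | bob {a b r : ℕ} (b' : Fin r → ℕ) (M : (i : Fin r) → Matrix (Fin (b' i)) (Fin b) ℂ)
      (complete : ∑ i, (M i)ᴴ * M i = 1) (next : (i : Fin r) → LOCC d N a (b' i)) : LOCC d N a b

/-- The unnormalized final state `p_α ρ_α` for the outcome `α` of a protocol run on the pure state
`Ψ`.  An operator `M` of A (resp. B) sends the matrix `Ψ` to `M Ψ` (resp. `Ψ Mᵀ`). -/
def LOCC.output {d N : ℕ} : {a b : ℕ} → LOCC d N a b → Matrix (Fin a) (Fin b) ℂ → Fin N →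
    Matrix (Fin d × Fin d) (Fin d × Fin d) ℂ
  | _, _, .done β, Ψ, α => if β = α then pureDensity Ψ else 0
  | _, _, .alice _ M _ next, Ψ, α => ∑ i, (next i).output (M i * Ψ) α
  | _, _, .bob _ M _ next, Ψ, α => ∑ i, (next i).output (Ψ * (M i)ᵀ) α

/-- Some LOCC protocol converts the pure state `Ψ` of `ℂ^a ⊗ ℂ^b` into the ensemble in which the
(normalized) pure state `Φ α` of `ℂ^d ⊗ ℂ^d` occurs with probability `p α`, for `α : Fin N`. -/
def Converts {d a b N : ℕ} (Ψ : Matrix (Fin a) (Fin b) ℂ) (p : Fin N → ℝ)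
    (Φ : Fin N → Matrix (Fin d) (Fin d) ℂ) : Prop :=
  (∀ α, 0 ≤ p α) ∧ (∀ α, ∑ μ, ∑ ν, ‖Φ α μ ν‖ ^ 2 = 1) ∧
    ∃ P : LOCC d N a b, ∀ α, P.output Ψ α = ((p α : ℝ) : ℂ) • pureDensity (Φ α)

/-- The average `k`-concurrence of an ensemble of bipartite pure states. -/
def averageConcurrence {d N : ℕ} (k : ℕ) (p : Fin N → ℝ)
    (Φ : Fin N → Matrix (Fin d) (Fin d) ℂ) : ℝ :=
  ∑ α, p α * concurrence k (schmidtNumbers (Φ α))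

end QNet

end

/-! Everything reduces to majorization. With `μ = kronVec lam`, the parallel state is the single
diagonal state `∑ √μₓ |xx⟩`. The purification function keeps the entries of `μ↓` up to the first
index `j` at which the average of what is left is at least the current entry. From there on it takes
that average `c` at each remaining step (`exists_purifySeq_eq`). Hence `χ = 𝒫 μ` is the least
decreasing `d`-vector, in the majorization order, that majorizes `μ` (`purifySeq_majorized`).

Achievability is Nielsen's theorem. An explicit doubly stochastic matrix maps the zero-padded `χ` to
`μ↓` (`exists_doublyStochastic_purify`), and Birkhoff's theorem makes `μ` an average of permutations
of `χ`. A measures which permutation occurs and B undoes it, every branch of nonzero probability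
giving the same target (`converts_of_eq_sum_perm`).

Optimality: the sum of the `l` largest Schmidt numbers cannot decrease on average under LOCC
(`frobSq_proj_mul_le_output`, with Ky Fan's principle `frobSq_proj_mul_le`). So the averaged sorted
Schmidt vector `y` of an ensemble majorizes `μ`, hence also `χ`, and `χ` lies in the convex hull of
the permutations of `y` (`mem_convexHull_perm_of_majorized`). As `C_k` is symmetric and concave,
`C_k χ ≥ C_k y ≥ ∑ p_α C_k(Φ_α)`. Concavity comes from the Marcus–Lopes inequality: each ratio
`S_{j+1}/S_j` is superadditive, and `S_k` is the product of the first `k` of them. -/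

noncomputable section

namespace QNet

/-! ### Elementary symmetric polynomials over a finite set -/

section SymmetricFunctions

variable {ι : Type*}

/-- The `k`-th elementary symmetric polynomial in the variables `x i`, `i ∈ s`. -/
def symmOn (s : Finset ι) (k : ℕ) (x : ι → ℝ) : ℝ :=
  ∑ t ∈ s.powersetCard k, ∏ i ∈ t, x i

lemma symmOn_zero (s : Finset ι) (x : ι → ℝ) : symmOn s 0 x = 1 := by
  simp [symmOn]

lemma symmOn_of_card_lt {s : Finset ι} {k : ℕ} (h : s.card < k) (x : ι → ℝ) :
    symmOn s k x = 0 := by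
  simp [symmOn, Finset.powersetCard_eq_empty.2 h]

lemma symmOn_pos {s : Finset ι} {k : ℕ} (h : k ≤ s.card) {x : ι → ℝ} (hx : ∀ i, 0 < x i) :
    0 < symmOn s k x :=
  Finset.sum_pos (fun _ _ => Finset.prod_pos fun i _ => hx i) (Finset.powersetCard_nonempty.2 h)

lemma symmOn_nonneg (s : Finset ι) (k : ℕ) {x : ι → ℝ} (hx : ∀ i, 0 ≤ x i) :
    0 ≤ symmOn s k x :=
  Finset.sum_nonneg fun _ _ => Finset.prod_nonneg fun i _ => hx i

lemma symmOn_smul (s : Finset ι) (k : ℕ) (c : ℝ) (x : ι → ℝ) :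
    symmOn s k (c • x) = c ^ k * symmOn s k x := by
  unfold symmOn
  rw [Finset.mul_sum]
  refine Finset.sum_congr rfl fun t ht => ?_
  simp [Finset.prod_mul_distrib, (Finset.mem_powersetCard.1 ht).2]

lemma continuous_symmOn (s : Finset ι) (k : ℕ) : Continuous (symmOn s k) := by
  unfold symmOn
  fun_prop

/-- The ratio `S_{k+1} / S_k`. -/
def symmRatio (s : Finset ι) (k : ℕ) (x : ι → ℝ) : ℝ :=
  symmOn s (k + 1) x / symmOn s k x

lemma symmRatio_nonneg (s : Finset ι) (k : ℕ) {x : ι → ℝ} (hx : ∀ i, 0 < x i) :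
    0 ≤ symmRatio s k x :=
  div_nonneg (symmOn_nonneg _ _ fun i => (hx i).le) (symmOn_nonneg _ _ fun i => (hx i).le)

lemma prod_symmRatio {s : Finset ι} {k : ℕ} (h : k ≤ s.card) {x : ι → ℝ} (hx : ∀ i, 0 < x i) :
    ∏ j ∈ Finset.range k, symmRatio s j x = symmOn s k x := by
  induction k with
  | zero => simp [symmOn_zero]
  | succ k ih =>
    have := symmOn_pos (Nat.le_of_succ_le h) hx
    rw [Finset.prod_range_succ, ih (by omega), symmRatio, mul_div_cancel₀ _ this.ne']

variable [DecidableEq ι]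

lemma symmOn_insert {s : Finset ι} {i : ι} (hi : i ∉ s) (k : ℕ) (x : ι → ℝ) :
    symmOn (insert i s) (k + 1) x = symmOn s (k + 1) x + x i * symmOn s k x := by
  unfold symmOn
  rw [Finset.powersetCard_succ_insert hi, Finset.sum_union, Finset.sum_image, Finset.mul_sum]
  · congr 1
    refine Finset.sum_congr rfl fun t ht => ?_
    rw [Finset.prod_insert fun h => hi ((Finset.mem_powersetCard.1 ht).1 h)]
  · intro t ht u hu h
    have ht' : i ∉ t := fun h => hi ((Finset.mem_powersetCard.1 ht).1 h)
    have hu' : i ∉ u := fun h => hi ((Finset.mem_powersetCard.1 hu).1 h)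
    rw [← Finset.erase_insert ht', ← Finset.erase_insert hu', h]
  · rw [Finset.disjoint_left]
    intro t ht h
    obtain ⟨u, -, rfl⟩ := Finset.mem_image.1 h
    exact hi ((Finset.mem_powersetCard.1 ht).1 (Finset.mem_insert_self i u))

lemma symmOn_erase {s : Finset ι} {i : ι} (hi : i ∈ s) (k : ℕ) (x : ι → ℝ) :
    symmOn s (k + 1) x = symmOn (s.erase i) (k + 1) x + x i * symmOn (s.erase i) k x := by
  conv_lhs => rw [← Finset.insert_erase hi]
  exact symmOn_insert (Finset.notMem_erase i s) k x

/-- Each `(k+1)`-subset is counted once for every element `i` singled out of it. -/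
lemma sum_mul_symmOn_erase (s : Finset ι) (k : ℕ) (x : ι → ℝ) :
    ∑ i ∈ s, x i * symmOn (s.erase i) k x = (k + 1) * symmOn s (k + 1) x := by
  induction s using Finset.induction_on generalizing k with
  | empty => simp [symmOn_of_card_lt (show (∅ : Finset ι).card < k + 1 by simp)]
  | insert a s ha ih =>
    have hs : ∀ i ∈ s, (insert a s).erase i = insert a (s.erase i) := fun i hi =>
      Finset.erase_insert_of_ne fun h => ha (h ▸ hi)
    have ha' : ∀ i, a ∉ s.erase i := fun i h => ha (Finset.mem_of_mem_erase h)
    rw [Finset.sum_insert ha, Finset.erase_insert ha, symmOn_insert ha,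
      Finset.sum_congr rfl fun i hi => by rw [hs i hi]]
    cases k with
    | zero =>
      have := ih 0
      simp only [symmOn_zero] at this ⊢
      rw [this]; push_cast; ring
    | succ k =>
      rw [Finset.sum_congr rfl fun i _ => by rw [symmOn_insert (ha' i), mul_add],
        Finset.sum_add_distrib, ih (k + 1),
        Finset.sum_congr rfl fun i _ => mul_left_comm (x i) (x a) _, ← Finset.mul_sum, ih k]
      push_cast; ring

/-- The recursion behind Marcus–Lopes. The `i`-th term is `x i * S_{k+1}(s \ i) / S_{k+1}(s)`, so
`sum_mul_symmOn_erase` gives the sum. In the form displayed, each term is linear minus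
quadratic-over-linear and increases with the smaller ratio, so superadditivity is inherited. -/
lemma symmRatio_succ {s : Finset ι} {k : ℕ} (h : k + 2 ≤ s.card) {x : ι → ℝ}
    (hx : ∀ i, 0 < x i) :
    (k + 2) * symmRatio s (k + 1) x =
      ∑ i ∈ s, (x i - x i ^ 2 / (x i + symmRatio (s.erase i) k x)) := by
  have key : ∀ i ∈ s, x i - x i ^ 2 / (x i + symmRatio (s.erase i) k x) =
      x i * symmOn (s.erase i) (k + 1) x / symmOn s (k + 1) x := by
    intro i hi
    have hc : k + 1 ≤ (s.erase i).card := by rw [Finset.card_erase_of_mem hi]; omega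
    have h1 := symmOn_pos hc hx
    have h0 := symmOn_pos (Nat.le_of_succ_le hc) hx
    have hxi := hx i
    have h2 : 0 < symmOn (s.erase i) (k + 1) x + x i * symmOn (s.erase i) k x := by positivity
    have h3 : 0 < x i + symmOn (s.erase i) (k + 1) x / symmOn (s.erase i) k x := by positivity
    rw [symmOn_erase hi k, symmRatio]
    have h4 : x i * symmOn (s.erase i) k x + symmOn (s.erase i) (k + 1) x ≠ 0 := by positivity
    field_simp
    ring
  rw [Finset.sum_congr rfl key, ← Finset.sum_div, sum_mul_symmOn_erase, symmRatio]
  push_cast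
  ring

lemma add_sq_div_add_le {a b c d : ℝ} (hc : 0 < c) (hd : 0 < d) :
    (a + b) ^ 2 / (c + d) ≤ a ^ 2 / c + b ^ 2 / d := by
  rw [div_add_div _ _ hc.ne' hd.ne', div_le_div_iff₀ (by positivity) (by positivity)]
  nlinarith [mul_nonneg hc.le hd.le, sq_nonneg (a * d - b * c)]

/-- Induction on `k` for all `s` at once: enlarging the inner ratio shrinks the subtracted fraction,
and `add_sq_div_add_le` splits it. When `s` has fewer than `k + 2` elements, the numerators vanish.
-/
theorem symmRatio_superadditive (s : Finset ι) (k : ℕ) {x y : ι → ℝ} (hx : ∀ i, 0 < x i)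
    (hy : ∀ i, 0 < y i) : symmRatio s k x + symmRatio s k y ≤ symmRatio s k (x + y) := by
  have hxy : ∀ i, 0 < (x + y) i := fun i => add_pos (hx i) (hy i)
  induction k generalizing s with
  | zero =>
    have h1 : ∀ z : ι → ℝ, symmOn s 1 z = ∑ i ∈ s, z i := by
      intro z
      simpa [symmOn_zero] using (sum_mul_symmOn_erase s 0 z).symm
    simp [symmRatio, symmOn_zero, h1, Finset.sum_add_distrib]
  | succ k ih =>
    by_cases hc : k + 2 ≤ s.card
    · refine le_of_mul_le_mul_left ?_ (show (0 : ℝ) < k + 2 by positivity)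
      rw [mul_add, symmRatio_succ hc hx, symmRatio_succ hc hy, symmRatio_succ hc hxy,
        ← Finset.sum_add_distrib]
      refine Finset.sum_le_sum fun i _ => ?_
      have hrx := symmRatio_nonneg (s.erase i) k hx
      have hry := symmRatio_nonneg (s.erase i) k hy
      have h1 := add_sq_div_add_le (a := x i) (b := y i)
        (add_pos_of_pos_of_nonneg (hx i) hrx) (add_pos_of_pos_of_nonneg (hy i) hry)
      have h2 : (x i + y i) ^ 2 / (x i + y i + symmRatio (s.erase i) k (x + y)) ≤
          (x i + y i) ^ 2 / (x i + symmRatio (s.erase i) k x +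
            (y i + symmRatio (s.erase i) k y)) := by
        refine div_le_div_of_nonneg_left (sq_nonneg _) ?_ ?_
        · linarith [hx i, hy i]
        · linarith [ih (s.erase i)]
      simp only [Pi.add_apply]
      linarith
    · simp [symmRatio, symmOn_of_card_lt (show s.card < k + 1 + 1 by omega)]

/-- Superadditivity of the geometric mean. -/
lemma rpow_prod_add_le {k : ℕ} (hk : 1 ≤ k) {a b : ℕ → ℝ} (ha : ∀ j < k, 0 < a j)
    (hb : ∀ j < k, 0 < b j) :
    (∏ j ∈ Finset.range k, a j) ^ ((1 : ℝ) / k) + (∏ j ∈ Finset.range k, b j) ^ ((1 : ℝ) / k) ≤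
      (∏ j ∈ Finset.range k, (a j + b j)) ^ ((1 : ℝ) / k) := by
  have hk0 : (0 : ℝ) < k := by exact_mod_cast hk
  have amgm : ∀ z : ℕ → ℝ, (∀ j < k, 0 < z j) →
      (∏ j ∈ Finset.range k, z j) ^ ((1 : ℝ) / k) ≤ ∑ j ∈ Finset.range k, (1 / k : ℝ) * z j := by
    intro z hz
    rw [← Real.finsetProd_rpow _ _ fun j hj => (hz j (Finset.mem_range.1 hj)).le]
    exact Real.geom_mean_le_arith_mean_weighted _ _ _ (fun _ _ => by positivity)
      (by simp [hk0.ne']) fun j hj => (hz j (Finset.mem_range.1 hj)).le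
  have hab : ∀ j < k, 0 < a j + b j := fun j hj => add_pos (ha j hj) (hb j hj)
  have hP : 0 < ∏ j ∈ Finset.range k, (a j + b j) :=
    Finset.prod_pos fun j hj => hab j (Finset.mem_range.1 hj)
  -- After division by the right-hand side, AM-GM applies to the fractions `a/(a+b)` and `b/(a+b)`,
  -- whose means add up to `1`.
  have h1 := amgm (fun j => a j / (a j + b j)) fun j hj => div_pos (ha j hj) (hab j hj)
  have h2 := amgm (fun j => b j / (a j + b j)) fun j hj => div_pos (hb j hj) (hab j hj)
  have h3 : ∑ j ∈ Finset.range k, (1 / k : ℝ) * (a j / (a j + b j)) +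
      ∑ j ∈ Finset.range k, (1 / k : ℝ) * (b j / (a j + b j)) = 1 := by
    rw [← Finset.sum_add_distrib]
    rw [Finset.sum_congr rfl (g := fun _ => (1 / k : ℝ))]
    · simp [hk0.ne']
    · intro j hj
      have := hab j (Finset.mem_range.1 hj)
      rw [← mul_add, ← add_div, div_self this.ne', mul_one]
  have hPa : 0 ≤ ∏ j ∈ Finset.range k, a j :=
    Finset.prod_nonneg fun j hj => (ha j (Finset.mem_range.1 hj)).le
  have hPb : 0 ≤ ∏ j ∈ Finset.range k, b j :=
    Finset.prod_nonneg fun j hj => (hb j (Finset.mem_range.1 hj)).le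
  rw [Finset.prod_div_distrib, Real.div_rpow hPa hP.le] at h1
  rw [Finset.prod_div_distrib, Real.div_rpow hPb hP.le] at h2
  have hr := Real.rpow_pos_of_pos hP ((1 : ℝ) / k)
  have h4 := add_le_add h1 h2
  rwa [h3, ← add_div, div_le_one hr] at h4

theorem symmOn_rpow_superadditive {s : Finset ι} {k : ℕ} (hk : 1 ≤ k) (h : k ≤ s.card)
    {x y : ι → ℝ} (hx : ∀ i, 0 ≤ x i) (hy : ∀ i, 0 ≤ y i) :
    symmOn s k x ^ ((1 : ℝ) / k) + symmOn s k y ^ ((1 : ℝ) / k) ≤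
      symmOn s k (x + y) ^ ((1 : ℝ) / k) := by
  have pos : ∀ x y : ι → ℝ, (∀ i, 0 < x i) → (∀ i, 0 < y i) →
      symmOn s k x ^ ((1 : ℝ) / k) + symmOn s k y ^ ((1 : ℝ) / k) ≤
        symmOn s k (x + y) ^ ((1 : ℝ) / k) := by
    intro x y hx hy
    have hr : ∀ z : ι → ℝ, (∀ i, 0 < z i) → ∀ j < k, 0 < symmRatio s j z := fun z hz j hj =>
      div_pos (symmOn_pos (by omega) hz) (symmOn_pos (by omega) hz)
    rw [← prod_symmRatio h hx, ← prod_symmRatio h hy,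
      ← prod_symmRatio (x := x + y) h fun i => add_pos (hx i) (hy i)]
    refine (rpow_prod_add_le hk (hr x hx) (hr y hy)).trans ?_
    refine Real.rpow_le_rpow (Finset.prod_nonneg fun j hj => ?_)
      (Finset.prod_le_prod (fun j hj => ?_) fun j _ => symmRatio_superadditive s j hx hy)
      (by positivity)
    all_goals
      exact add_nonneg (symmRatio_nonneg s j hx) (symmRatio_nonneg s j hy)
  -- The ratios need positive entries; the boundary is reached by adding `ε` to all entries of `x`
  -- and `y`, hence `2ε` to those of `x + y`.
  have cont : ∀ z w : ι → ℝ, Filter.Tendsto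
      (fun ε : ℝ => symmOn s k (z + ε • w) ^ ((1 : ℝ) / k))
      (nhdsWithin 0 (Set.Ioi 0)) (nhds (symmOn s k z ^ ((1 : ℝ) / k))) := by
    intro z w
    have hc : Continuous fun ε : ℝ => symmOn s k (z + ε • w) ^ ((1 : ℝ) / k) :=
      ((continuous_symmOn s k).comp (by fun_prop)).rpow_const fun _ => Or.inr (by positivity)
    simpa using (hc.tendsto 0).mono_left nhdsWithin_le_nhds
  refine le_of_tendsto_of_tendsto ((cont x 1).add (cont y 1)) (cont (x + y) 2) ?_
  filter_upwards [self_mem_nhdsWithin] with ε hε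
  have hε' : 0 < ε := hε
  have := pos (x + ε • (1 : ι → ℝ)) (y + ε • (1 : ι → ℝ))
    (fun i => by simpa using add_pos_of_nonneg_of_pos (hx i) hε')
    (fun i => by simpa using add_pos_of_nonneg_of_pos (hy i) hε')
  have e : x + y + ε • (2 : ι → ℝ) = x + ε • (1 : ι → ℝ) + (y + ε • (1 : ι → ℝ)) := by
    funext i
    simp only [Pi.add_apply, Pi.smul_apply, Pi.ofNat_apply, smul_eq_mul]
    ring
  rwa [← e] at this

end SymmetricFunctions

/-! ### Symmetry and concavity of the concurrences -/

lemma elemSymm_eq_symmOn {d : ℕ} (k : ℕ) (x : Fin d → ℝ) :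
    elemSymm k x = symmOn Finset.univ k x := by
  simp [elemSymm, MvPolynomial.esymm, symmOn]

lemma elemSymm_eq_multiset_esymm {d : ℕ} (k : ℕ) (x : Fin d → ℝ) :
    elemSymm k x = (Finset.univ.val.map x).esymm k := by
  rw [Finset.esymm_map_val, elemSymm_eq_symmOn, symmOn]

lemma concurrence_congr {d : ℕ} (k : ℕ) {x y : Fin d → ℝ}
    (h : Finset.univ.val.map x = Finset.univ.val.map y) : concurrence k x = concurrence k y := by
  simp only [concurrence, elemSymm_eq_multiset_esymm k x, elemSymm_eq_multiset_esymm k y, h]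

lemma concurrence_comp_perm {d : ℕ} (k : ℕ) (x : Fin d → ℝ) (σ : Equiv.Perm (Fin d)) :
    concurrence k (x ∘ σ) = concurrence k x := by
  refine concurrence_congr k ?_
  rw [← Multiset.map_map]
  congr 1
  exact congrArg Finset.val (Finset.map_univ_equiv σ)

/-- Superadditivity together with homogeneity of degree one is concavity. -/
theorem concaveOn_concurrence {d k : ℕ} (hk : 1 ≤ k) (hkd : k ≤ d) :
    ConcaveOn ℝ {x : Fin d → ℝ | ∀ i, 0 ≤ x i} (concurrence k) := by
  have hconv : Convex ℝ {x : Fin d → ℝ | ∀ i, 0 ≤ x i} := by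
    intro x hx y hy a b ha hb _ i
    exact add_nonneg (mul_nonneg ha (hx i)) (mul_nonneg hb (hy i))
  have hk0 : (k : ℝ) ≠ 0 := by positivity
  have hc : 0 ≤ elemSymm k (fun _ : Fin d => (1 : ℝ) / (d : ℝ)) := by
    rw [elemSymm_eq_symmOn]
    exact symmOn_nonneg _ _ fun _ => by positivity
  have hom : ∀ (c : ℝ) (x : Fin d → ℝ), 0 ≤ c → (∀ i, 0 ≤ x i) →
      symmOn Finset.univ k (c • x) ^ ((1 : ℝ) / k) =
        c * symmOn Finset.univ k x ^ ((1 : ℝ) / k) := by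
    intro c x hc hx
    rw [symmOn_smul, Real.mul_rpow (by positivity) (symmOn_nonneg _ _ hx), ← Real.rpow_natCast,
      ← Real.rpow_mul hc, mul_one_div_cancel hk0, Real.rpow_one]
  refine ⟨hconv, fun x hx y hy a b ha hb hab => ?_⟩
  have hx' : ∀ i, 0 ≤ (a • x) i := fun i => mul_nonneg ha (hx i)
  have hy' : ∀ i, 0 ≤ (b • y) i := fun i => mul_nonneg hb (hy i)
  have h := symmOn_rpow_superadditive (s := Finset.univ) hk (by simpa using hkd) hx' hy'
  rw [hom a x ha hx, hom b y hb hy] at h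
  simp only [concurrence, smul_eq_mul]
  simp only [elemSymm_eq_symmOn k x, elemSymm_eq_symmOn k y, elemSymm_eq_symmOn k (a • x + b • y)]
  rw [Real.div_rpow (symmOn_nonneg _ _ hx) hc, Real.div_rpow (symmOn_nonneg _ _ hy) hc,
    Real.div_rpow (symmOn_nonneg _ _ (hconv hx hy ha hb hab)) hc, ← mul_div_assoc,
    ← mul_div_assoc, ← add_div]
  exact div_le_div_of_nonneg_right h (by positivity)

/-! ### Frobenius norm and projections -/

/-- The squared Frobenius norm. -/
def frobSq {a b : ℕ} (X : Matrix (Fin a) (Fin b) ℂ) : ℝ :=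
  ∑ i, ∑ j, ‖X i j‖ ^ 2

lemma frobSq_nonneg {a b : ℕ} (X : Matrix (Fin a) (Fin b) ℂ) : 0 ≤ frobSq X :=
  Finset.sum_nonneg fun _ _ => Finset.sum_nonneg fun _ _ => sq_nonneg _

lemma ofReal_frobSq {a b : ℕ} (X : Matrix (Fin a) (Fin b) ℂ) :
    (frobSq X : ℂ) = (X * Xᴴ).trace := by
  simp only [frobSq, trace, diag_apply, mul_apply, conjTranspose_apply, Complex.ofReal_sum]
  refine Finset.sum_congr rfl fun i _ => Finset.sum_congr rfl fun j _ => ?_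
  rw [Complex.star_def, Complex.mul_conj, Complex.normSq_eq_norm_sq]

lemma ofReal_frobSq' {a b : ℕ} (X : Matrix (Fin a) (Fin b) ℂ) :
    (frobSq X : ℂ) = (Xᴴ * X).trace := by
  rw [ofReal_frobSq, trace_mul_comm]

lemma frobSq_conjTranspose {a b : ℕ} (X : Matrix (Fin a) (Fin b) ℂ) : frobSq Xᴴ = frobSq X := by
  have := ofReal_frobSq' X
  rw [← Complex.ofReal_inj, this, ofReal_frobSq, conjTranspose_conjTranspose]

lemma frobSq_smul {a b : ℕ} (c : ℂ) (X : Matrix (Fin a) (Fin b) ℂ) :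
    frobSq (c • X) = ‖c‖ ^ 2 * frobSq X := by
  simp [frobSq, Finset.mul_sum, mul_pow]

lemma sum_frobSq_mul_left {a b r : ℕ} {a' : Fin r → ℕ}
    {M : (i : Fin r) → Matrix (Fin (a' i)) (Fin a) ℂ} (hM : ∑ i, (M i)ᴴ * M i = 1)
    (X : Matrix (Fin a) (Fin b) ℂ) : ∑ i, frobSq (M i * X) = frobSq X := by
  rw [← Complex.ofReal_inj]
  push_cast
  simp only [ofReal_frobSq']
  have : ∀ i, (M i * X)ᴴ * (M i * X) = Xᴴ * ((M i)ᴴ * M i) * X := fun i => by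
    simp [conjTranspose_mul, Matrix.mul_assoc]
  simp_rw [this]
  rw [← trace_sum, ← Matrix.sum_mul, ← Matrix.mul_sum, hM, Matrix.mul_one]

lemma sum_frobSq_mul_right {a b r : ℕ} {b' : Fin r → ℕ}
    {M : (i : Fin r) → Matrix (Fin (b' i)) (Fin b) ℂ} (hM : ∑ i, (M i)ᴴ * M i = 1)
    (X : Matrix (Fin a) (Fin b) ℂ) : ∑ i, frobSq (X * (M i)ᵀ) = frobSq X := by
  rw [← Complex.ofReal_inj]
  push_cast
  simp only [ofReal_frobSq]
  have : ∀ i, X * (M i)ᵀ * (X * (M i)ᵀ)ᴴ = X * ((M i)ᴴ * M i)ᵀ * Xᴴ := fun i => by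
    simp only [conjTranspose_mul, Matrix.mul_assoc, transpose_mul]
    rfl
  simp_rw [this]
  rw [← trace_sum, ← Matrix.sum_mul, ← Matrix.mul_sum, ← transpose_sum, hM, transpose_one,
    Matrix.mul_one]

/-- Orthogonal projections of rank at most `l`. -/
structure IsProjOfRankLE {a : ℕ} (l : ℕ) (P : Matrix (Fin a) (Fin a) ℂ) : Prop where
  herm : Pᴴ = P
  idem : P * P = P
  rank_le : P.rank ≤ l
  trace_le : P.trace.re ≤ l

lemma IsProjOfRankLE.frobSq_mul_le {a b l : ℕ} {P : Matrix (Fin a) (Fin a) ℂ}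
    (hP : IsProjOfRankLE l P) (X : Matrix (Fin a) (Fin b) ℂ) : frobSq (P * X) ≤ frobSq X := by
  have h : frobSq X = frobSq (P * X) + frobSq ((1 - P) * X) := by
    rw [← Complex.ofReal_inj]
    push_cast
    simp only [ofReal_frobSq', conjTranspose_mul, conjTranspose_sub, conjTranspose_one, hP.herm]
    rw [← trace_add]
    congr 1
    have h1 : Xᴴ * P * (P * X) = Xᴴ * (P * P) * X := by simp only [Matrix.mul_assoc]
    have h2 : Xᴴ * (1 - P) * ((1 - P) * X) = Xᴴ * ((1 - P) * (1 - P)) * X := by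
      simp only [Matrix.mul_assoc]
    have h3 : (1 - P) * (1 - P) = 1 - P := by
      rw [Matrix.mul_sub, Matrix.sub_mul, Matrix.sub_mul, hP.idem]; simp
    rw [h1, h2, h3, hP.idem, ← Matrix.add_mul, ← Matrix.mul_add]
    simp
  linarith [frobSq_nonneg ((1 - P) * X)]

lemma IsProjOfRankLE.frobSq_mul_le' {a b l : ℕ} {Q : Matrix (Fin b) (Fin b) ℂ}
    (hQ : IsProjOfRankLE l Q) (X : Matrix (Fin a) (Fin b) ℂ) : frobSq (X * Q) ≤ frobSq X := by
  rw [← frobSq_conjTranspose (X * Q), ← frobSq_conjTranspose X, conjTranspose_mul, hQ.herm]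
  exact hQ.frobSq_mul_le _

open scoped ComplexOrder in
/-- The orthogonal projection onto the column space of a matrix. -/
lemma exists_isProj_mul_eq {a b : ℕ} (W : Matrix (Fin a) (Fin b) ℂ) :
    ∃ P : Matrix (Fin a) (Fin a) ℂ, IsProjOfRankLE W.rank P ∧ P * W = W := by
  have hA := Matrix.isHermitian_mul_conjTranspose_self W
  set U : Matrix (Fin a) (Fin a) ℂ := (hA.eigenvectorUnitary : Matrix (Fin a) (Fin a) ℂ) with hU
  have hUU : Uᴴ * U = 1 := Unitary.coe_star_mul_self hA.eigenvectorUnitary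
  set D : Matrix (Fin a) (Fin a) ℂ := diagonal (fun i => (hA.eigenvalues i : ℂ)) with hD
  -- `E` selects the eigenvectors of `W Wᴴ` with nonzero eigenvalue, which span the column space of
  -- `W`.
  set E : Matrix (Fin a) (Fin a) ℂ :=
    diagonal (fun i => if hA.eigenvalues i ≠ 0 then (1 : ℂ) else 0) with hE
  have hspec : W * Wᴴ = U * D * Uᴴ := hA.spectral_theorem
  have hEE : E * E = E := by simp [hE]
  have hEH : Eᴴ = E := by
    rw [hE, diagonal_conjTranspose]
    congr 1
    ext i
    simp [apply_ite]
  have hED : E * D = D := by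
    rw [hE, hD, diagonal_mul_diagonal]
    congr 1
    ext i
    by_cases h : hA.eigenvalues i = 0 <;> simp [h]
  have hrank : W.rank = Fintype.card {i // hA.eigenvalues i ≠ 0} := by
    rw [← rank_self_mul_conjTranspose, hA.rank_eq_card_non_zero_eigs]
  have hErank : E.rank = W.rank := by
    rw [hE, rank_diagonal, hrank]
    refine Fintype.card_congr (Equiv.subtypeEquivRight fun i => ?_)
    simp
  have hEtr : E.trace.re = W.rank := by
    rw [hE, trace_diagonal, hrank, Fintype.card_subtype]
    simp [Finset.sum_ite]
  have hmid : U * E * Uᴴ * (U * D * Uᴴ) = U * D * Uᴴ := by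
    calc U * E * Uᴴ * (U * D * Uᴴ) = U * E * (Uᴴ * U) * D * Uᴴ := by simp only [Matrix.mul_assoc]
      _ = U * (E * D) * Uᴴ := by rw [hUU]; simp only [Matrix.mul_assoc, Matrix.one_mul]
      _ = U * D * Uᴴ := by rw [hED]
  have hherm : (U * E * Uᴴ)ᴴ = U * E * Uᴴ := by
    simp [conjTranspose_mul, hEH, Matrix.mul_assoc]
  refine ⟨U * E * Uᴴ, ⟨hherm, ?_, ?_, ?_⟩, ?_⟩
  · calc U * E * Uᴴ * (U * E * Uᴴ) = U * E * (Uᴴ * U) * E * Uᴴ := by simp only [Matrix.mul_assoc]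
      _ = U * (E * E) * Uᴴ := by rw [hUU]; simp only [Matrix.mul_assoc, Matrix.one_mul]
      _ = U * E * Uᴴ := by rw [hEE]
  · exact ((rank_mul_le_left _ _).trans (rank_mul_le_right _ _)).trans hErank.le
  · rw [trace_mul_comm, ← Matrix.mul_assoc, hUU, Matrix.one_mul, hEtr]
  · set P := U * E * Uᴴ with hP
    -- Expanding the product leaves only `W Wᴴ`, which `P` fixes on both sides.
    have h0 : (P * W - W) * (P * W - W)ᴴ = 0 := by
      have e1 : (P * W - W) * (P * W - W)ᴴ =
          P * (W * Wᴴ) * P - P * (W * Wᴴ) - (W * Wᴴ) * P + W * Wᴴ := by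
        rw [conjTranspose_sub, conjTranspose_mul, hherm]
        simp only [Matrix.sub_mul, Matrix.mul_sub, Matrix.mul_assoc]
        abel
      have e2 : P * (W * Wᴴ) = W * Wᴴ := by rw [hspec]; exact hmid
      have e3 : (W * Wᴴ) * P = W * Wᴴ := by
        have := congrArg conjTranspose e2
        rwa [conjTranspose_mul, hherm, hA.eq] at this
      rw [e1, e2, e3]
      abel
    exact sub_eq_zero.1 (self_mul_conjTranspose_eq_zero.1 h0)

lemma IsProjOfRankLE.mono {a l l' : ℕ} {P : Matrix (Fin a) (Fin a) ℂ}
    (hP : IsProjOfRankLE l P) (h : l ≤ l') : IsProjOfRankLE l' P :=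
  ⟨hP.herm, hP.idem, hP.rank_le.trans h, hP.trace_le.trans (by exact_mod_cast h)⟩

-- Moves a test projection from A's side to B's. With `Q` the projection onto the column space of
-- `(P X)ᴴ`, one has `P X = P X Q`, and dropping `P` cannot lower the norm.
open scoped ComplexOrder in
lemma exists_right_proj {a b l : ℕ} {P : Matrix (Fin a) (Fin a) ℂ} (hP : IsProjOfRankLE l P)
    (X : Matrix (Fin a) (Fin b) ℂ) :
    ∃ Q : Matrix (Fin b) (Fin b) ℂ, IsProjOfRankLE l Q ∧ frobSq (P * X) ≤ frobSq (X * Q) := by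
  obtain ⟨Q, hQ, hQX⟩ := exists_isProj_mul_eq (P * X)ᴴ
  have hr : (P * X)ᴴ.rank ≤ l := by
    rw [rank_conjTranspose]
    exact (rank_mul_le_left _ _).trans hP.rank_le
  refine ⟨Q, hQ.mono hr, ?_⟩
  have h := congrArg conjTranspose hQX
  rw [conjTranspose_mul, conjTranspose_conjTranspose, hQ.herm, Matrix.mul_assoc] at h
  rw [← h]
  exact hP.frobSq_mul_le _

lemma exists_left_proj {a b l : ℕ} {Q : Matrix (Fin b) (Fin b) ℂ} (hQ : IsProjOfRankLE l Q)
    (X : Matrix (Fin a) (Fin b) ℂ) :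
    ∃ P : Matrix (Fin a) (Fin a) ℂ, IsProjOfRankLE l P ∧ frobSq (X * Q) ≤ frobSq (P * X) := by
  obtain ⟨P, hP, hPX⟩ := exists_isProj_mul_eq (X * Q)
  refine ⟨P, hP.mono ((rank_mul_le_right _ _).trans hQ.rank_le), ?_⟩
  rw [← hPX, ← Matrix.mul_assoc]
  exact hQ.frobSq_mul_le' _

/-! ### Outputs of LOCC protocols -/

/-- The overlap `⟨V|X⟩`. -/
def overlap {d : ℕ} (V X : Matrix (Fin d) (Fin d) ℂ) : ℂ :=
  ∑ x : Fin d × Fin d, star (V x.1 x.2) * X x.1 x.2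

/-- The expectation `⟨V|ρ|V⟩`. -/
def expectation {d : ℕ} (V : Matrix (Fin d) (Fin d) ℂ)
    (ρ : Matrix (Fin d × Fin d) (Fin d × Fin d) ℂ) : ℝ :=
  (∑ x, ∑ y, star (V x.1 x.2) * ρ x y * V y.1 y.2).re

lemma overlap_self {d : ℕ} (V : Matrix (Fin d) (Fin d) ℂ) : overlap V V = frobSq V := by
  simp only [overlap, frobSq, Fintype.sum_prod_type, Complex.ofReal_sum]
  refine Finset.sum_congr rfl fun i _ => Finset.sum_congr rfl fun j _ => ?_
  rw [mul_comm, Complex.star_def, Complex.mul_conj, Complex.normSq_eq_norm_sq]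

lemma overlap_sub_right {d : ℕ} (V X Y : Matrix (Fin d) (Fin d) ℂ) :
    overlap V (X - Y) = overlap V X - overlap V Y := by
  simp [overlap, mul_sub]

lemma overlap_smul_right {d : ℕ} (c : ℂ) (V X : Matrix (Fin d) (Fin d) ℂ) :
    overlap V (c • X) = c * overlap V X := by
  simp [overlap, Finset.mul_sum, mul_left_comm]

lemma star_overlap {d : ℕ} (V X : Matrix (Fin d) (Fin d) ℂ) :
    star (overlap V X) = overlap X V := by
  simp [overlap, mul_comm]

lemma expectation_sum {d r : ℕ} (V : Matrix (Fin d) (Fin d) ℂ)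
    (ρ : Fin r → Matrix (Fin d × Fin d) (Fin d × Fin d) ℂ) :
    expectation V (∑ i, ρ i) = ∑ i, expectation V (ρ i) := by
  simp only [expectation, ← Complex.re_sum]
  congr 1
  symm
  rw [Finset.sum_comm]
  refine Finset.sum_congr rfl fun x _ => ?_
  rw [Finset.sum_comm]
  refine Finset.sum_congr rfl fun y _ => ?_
  rw [Matrix.sum_apply, Finset.mul_sum, Finset.sum_mul]

lemma expectation_pureDensity {d : ℕ} (V X : Matrix (Fin d) (Fin d) ℂ) :
    expectation V (pureDensity X) = ‖overlap V X‖ ^ 2 := by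
  have : ∑ x : Fin d × Fin d, ∑ y : Fin d × Fin d,
      star (V x.1 x.2) * pureDensity X x y * V y.1 y.2 =
      overlap V X * star (overlap V X) := by
    rw [star_overlap, overlap, overlap, Finset.sum_mul_sum]
    refine Finset.sum_congr rfl fun x _ => Finset.sum_congr rfl fun y _ => ?_
    simp only [pureDensity, of_apply]
    ring
  rw [expectation, this, Complex.star_def, Complex.mul_conj, Complex.normSq_eq_norm_sq,
    Complex.ofReal_re]

lemma trace_pureDensity {d : ℕ} (X : Matrix (Fin d) (Fin d) ℂ) :
    (pureDensity X).trace = frobSq X := by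
  rw [← overlap_self, overlap, trace]
  refine Finset.sum_congr rfl fun x _ => ?_
  simp [pureDensity, mul_comm]

lemma expectation_zero {d : ℕ} (V : Matrix (Fin d) (Fin d) ℂ) : expectation V 0 = 0 := by
  simp [expectation]

/-- Lets a vanishing expectation of the total output be read off in every branch separately. -/
lemma expectation_output_nonneg {d N a b : ℕ} (P : LOCC d N a b) (Ψ : Matrix (Fin a) (Fin b) ℂ)
    (V : Matrix (Fin d) (Fin d) ℂ) (α : Fin N) : 0 ≤ expectation V (P.output Ψ α) := by
  induction P with
  | done β =>
    simp only [LOCC.output]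
    split_ifs
    · rw [expectation_pureDensity]; positivity
    · rw [expectation_zero]
  | alice a' M hM next ih =>
    simp only [LOCC.output, expectation_sum]
    exact Finset.sum_nonneg fun i _ => ih i _
  | bob b' M hM next ih =>
    simp only [LOCC.output, expectation_sum]
    exact Finset.sum_nonneg fun i _ => ih i _

lemma sum_trace_output {d N a b : ℕ} (P : LOCC d N a b) (Ψ : Matrix (Fin a) (Fin b) ℂ) :
    ∑ α, (P.output Ψ α).trace.re = frobSq Ψ := by
  induction P with
  | done β =>
    simp only [LOCC.output]
    rw [Finset.sum_eq_single β]
    · simp [trace_pureDensity]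
    · intro α _ h
      simp [h.symm]
    · simp
  | alice a' M hM next ih =>
    simp only [LOCC.output, trace_sum, Complex.re_sum]
    rw [Finset.sum_comm, ← sum_frobSq_mul_left hM]
    exact Finset.sum_congr rfl fun i _ => ih i _
  | bob b' M hM next ih =>
    simp only [LOCC.output, trace_sum, Complex.re_sum]
    rw [Finset.sum_comm, ← sum_frobSq_mul_right hM]
    exact Finset.sum_congr rfl fun i _ => ih i _

/-- The part of `X` orthogonal to `Φ` is by hypothesis orthogonal to `X`, hence to itself. -/
lemma eq_smul_of_overlap {d : ℕ} {Φ X : Matrix (Fin d) (Fin d) ℂ} (hΦ : frobSq Φ = 1)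
    (h : ∀ V, overlap V Φ = 0 → overlap V X = 0) : X = overlap Φ X • Φ := by
  set c := overlap Φ X with hc
  have h1 : overlap (X - c • Φ) Φ = 0 := by
    rw [← star_overlap, overlap_sub_right, overlap_smul_right, overlap_self, hΦ, hc]
    simp
  have h2 : frobSq (X - c • Φ) = 0 := by
    rw [← Complex.ofReal_inj, ← overlap_self, overlap_sub_right, overlap_smul_right, h _ h1, h1]
    simp
  have h3 : ∀ i j, (X - c • Φ) i j = 0 := by
    intro i j
    have h4 := (Finset.sum_eq_zero_iff_of_nonneg fun i _ =>
      Finset.sum_nonneg fun j _ => sq_nonneg _).1 h2 i (Finset.mem_univ i)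
    have h5 := (Finset.sum_eq_zero_iff_of_nonneg fun j _ => sq_nonneg _).1 h4 j
      (Finset.mem_univ j)
    simpa using h5
  exact sub_eq_zero.1 (Matrix.ext h3)

/-- Monotonicity of the Ky Fan functionals under LOCC. -/
theorem frobSq_proj_mul_le_output {d N l : ℕ} {Φ : Fin N → Matrix (Fin d) (Fin d) ℂ}
    (hΦ : ∀ α, frobSq (Φ α) = 1) {e : Fin N → ℝ}
    (he : ∀ α R, IsProjOfRankLE l R → frobSq (R * Φ α) ≤ e α) {a b : ℕ} (P : LOCC d N a b)
    (Ψ : Matrix (Fin a) (Fin b) ℂ)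
    (hout : ∀ α V, overlap V (Φ α) = 0 → expectation V (P.output Ψ α) = 0)
    {R : Matrix (Fin a) (Fin a) ℂ} (hR : IsProjOfRankLE l R) :
    frobSq (R * Ψ) ≤ ∑ α, e α * (P.output Ψ α).trace.re := by
  -- The hypothesis `hout` says only that each output is supported on `Φ α`, so it passes to every
  -- branch of the protocol.
  induction P with
  | done β =>
    have hX : Ψ = overlap (Φ β) Ψ • Φ β := by
      refine eq_smul_of_overlap (hΦ β) fun V hV => ?_
      have := hout β V hV
      simp only [LOCC.output, if_true, expectation_pureDensity] at this
      simpa using this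
    rw [Finset.sum_eq_single β]
    · simp only [LOCC.output, if_true, trace_pureDensity, Complex.ofReal_re]
      rw [hX, Matrix.mul_smul, frobSq_smul, frobSq_smul, hΦ, mul_one, mul_comm]
      exact mul_le_mul_of_nonneg_right (he β R hR) (sq_nonneg _)
    · intro α _ h
      simp [LOCC.output, h.symm]
    · simp
  | alice a' M hM next ih =>
    -- On B's side the projection commutes with A's operators, so completeness splits the norm over
    -- the outcomes; in each branch the projection is then moved back to A's side.
    obtain ⟨Q, hQ, hle⟩ := exists_right_proj hR Ψ
    refine hle.trans ?_
    rw [← sum_frobSq_mul_left hM]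
    simp only [LOCC.output, trace_sum, Complex.re_sum, Finset.mul_sum]
    rw [Finset.sum_comm]
    refine Finset.sum_le_sum fun i _ => ?_
    rw [← Matrix.mul_assoc]
    obtain ⟨S, hS, hle'⟩ := exists_left_proj hQ (M i * Ψ)
    refine hle'.trans (ih i _ (fun α V hV => ?_) hS)
    have := hout α V hV
    simp only [LOCC.output, expectation_sum] at this
    exact (Finset.sum_eq_zero_iff_of_nonneg fun i _ =>
      expectation_output_nonneg _ _ _ _).1 this i (Finset.mem_univ i)
  | bob b' M hM next ih =>
    -- B's operators already commute with a projection on A's side.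
    rw [← sum_frobSq_mul_right hM]
    simp only [LOCC.output, trace_sum, Complex.re_sum, Finset.mul_sum]
    rw [Finset.sum_comm]
    refine Finset.sum_le_sum fun i _ => ?_
    rw [Matrix.mul_assoc]
    refine ih i _ (fun α V hV => ?_) hR
    have := hout α V hV
    simp only [LOCC.output, expectation_sum] at this
    exact (Finset.sum_eq_zero_iff_of_nonneg fun i _ =>
      expectation_output_nonneg _ _ _ _).1 this i (Finset.mem_univ i)

/-! ### Decreasing rearrangements -/

lemma sortDesc_coe {m : ℕ} (x : Fin m → ℝ) (i : Fin m) :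
    sortDesc x i = x (Tuple.sort (fun i => -x i) i) := by
  simp [sortDesc]

lemma sortDesc_le_of_lt {m : ℕ} (x : Fin m → ℝ) {i j : ℕ} (hij : i ≤ j) (hj : j < m) :
    sortDesc x j ≤ sortDesc x i := by
  have h := Tuple.monotone_sort (fun i => -x i)
    (show (⟨i, hij.trans_lt hj⟩ : Fin m) ≤ ⟨j, hj⟩ from hij)
  simp only [Function.comp_apply, neg_le_neg_iff] at h
  simpa [sortDesc, hj, hij.trans_lt hj] using h

lemma sortDesc_nonneg {m : ℕ} {x : Fin m → ℝ} (hx : ∀ i, 0 ≤ x i) (l : ℕ) : 0 ≤ sortDesc x l := by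
  unfold sortDesc
  split_ifs
  · exact hx _
  · exact le_rfl

lemma sortDesc_antitone {m : ℕ} {x : Fin m → ℝ} (hx : ∀ i, 0 ≤ x i) : Antitone (sortDesc x) := by
  intro i j hij
  by_cases hj : j < m
  · exact sortDesc_le_of_lt x hij hj
  · have : sortDesc x j = 0 := by simp [sortDesc, hj]
    rw [this]
    exact sortDesc_nonneg hx i

lemma sum_sortDesc {m : ℕ} (x : Fin m → ℝ) : ∑ i ∈ Finset.range m, sortDesc x i = ∑ i, x i := by
  rw [← Fin.sum_univ_eq_sum_range (sortDesc x) m]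
  simp only [sortDesc_coe]
  exact Equiv.sum_comp (Tuple.sort fun i => -x i) x

lemma sum_range_ite_lt {d l : ℕ} (hl : l ≤ d) (f : ℕ → ℝ) :
    ∑ i : Fin d, (if (i : ℕ) < l then f i else 0) = ∑ i ∈ Finset.range l, f i := by
  rw [Fin.sum_univ_eq_sum_range (fun i => if i < l then f i else 0) d, ← Finset.sum_filter]
  congr 1
  ext i
  simp
  omega

/-- A weighted sum with weights in `[0, 1]` of total weight at most `l` is at most the sum of the
`l` largest terms. -/
lemma sum_mul_le_sum_sortDesc {d l : ℕ} (hl : l ≤ d) {x c : Fin d → ℝ} (hx : ∀ i, 0 ≤ x i)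
    (hc0 : ∀ i, 0 ≤ c i) (hc1 : ∀ i, c i ≤ 1) (hc : ∑ i, c i ≤ l) :
    ∑ i, x i * c i ≤ ∑ i ∈ Finset.range l, sortDesc x i := by
  set τ := Tuple.sort (fun i => -x i) with hτ
  have e1 : ∑ i, x i * c i = ∑ i : Fin d, sortDesc x i * c (τ i) := by
    rw [← Equiv.sum_comp τ]
    exact Finset.sum_congr rfl fun i _ => by rw [sortDesc_coe]
  have e2 : ∑ i : Fin d, c (τ i) = ∑ i, c i := Equiv.sum_comp τ c
  have e3 : ∑ i : Fin d, (if (i : ℕ) < l then (1 : ℝ) else 0) = l := by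
    rw [sum_range_ite_lt hl fun _ => 1]
    simp
  -- Termwise comparison with the threshold `x↓_l`: weights are at most `1` above it and at least
  -- `0` below it.
  have key : ∀ i : Fin d, sortDesc x i * c (τ i) ≤
      (if (i : ℕ) < l then sortDesc x i else 0) +
        sortDesc x l * (c (τ i) - if (i : ℕ) < l then 1 else 0) := by
    intro i
    split_ifs with h
    · have := sortDesc_antitone hx h.le
      nlinarith [hc1 (τ i)]
    · have := sortDesc_antitone hx (not_lt.1 h)
      nlinarith [hc0 (τ i)]
  rw [e1]
  refine (Finset.sum_le_sum fun i _ => key i).trans ?_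
  rw [Finset.sum_add_distrib, sum_range_ite_lt hl, ← Finset.mul_sum, Finset.sum_sub_distrib, e2, e3]
  have := sortDesc_nonneg hx l
  nlinarith

/-! ### Ky Fan's principle and the Schmidt numbers of an LOCC ensemble -/

open scoped ComplexOrder in
lemma schmidtNumbers_nonneg {d : ℕ} (Φ : Matrix (Fin d) (Fin d) ℂ) (i : Fin d) :
    0 ≤ schmidtNumbers Φ i :=
  (posSemidef_self_mul_conjTranspose Φ).eigenvalues_nonneg i

/-- The Ky Fan maximum principle. -/
theorem frobSq_proj_mul_le {d l : ℕ} (hl : l ≤ d) (Φ : Matrix (Fin d) (Fin d) ℂ)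
    {R : Matrix (Fin d) (Fin d) ℂ} (hR : IsProjOfRankLE l R) :
    frobSq (R * Φ) ≤ ∑ i ∈ Finset.range l, sortDesc (schmidtNumbers Φ) i := by
  have hA := Matrix.isHermitian_mul_conjTranspose_self Φ
  set U : Matrix (Fin d) (Fin d) ℂ := (hA.eigenvectorUnitary : Matrix (Fin d) (Fin d) ℂ) with hU
  have hUU : Uᴴ * U = 1 := Unitary.coe_star_mul_self hA.eigenvectorUnitary
  have hUU' : U * Uᴴ = 1 := Unitary.coe_mul_star_self hA.eigenvectorUnitary
  have hspec : Φ * Φᴴ = U * diagonal (fun i => (schmidtNumbers Φ i : ℂ)) * Uᴴ := hA.spectral_theorem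
  -- `c i` is the squared norm of the projection by `R` of the `i`-th eigenvector: it lies in `[0,
  -- 1]`, and the total is `tr R ≤ l`.
  set c : Fin d → ℝ := fun i => ∑ j, ‖(R * U) j i‖ ^ 2 with hc
  have e1 : frobSq (R * Φ) = ∑ i, schmidtNumbers Φ i * c i := by
    have h1 : R * Φ * (R * Φ)ᴴ =
        (R * U) * diagonal (fun i => (schmidtNumbers Φ i : ℂ)) * (R * U)ᴴ := by
      calc R * Φ * (R * Φ)ᴴ = R * (Φ * Φᴴ) * Rᴴ := by
            simp only [conjTranspose_mul, Matrix.mul_assoc]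
        _ = _ := by rw [hspec]; simp only [conjTranspose_mul, Matrix.mul_assoc]
    rw [← Complex.ofReal_inj, ofReal_frobSq, h1, trace]
    simp only [diag_apply, mul_apply (M := R * U * _), mul_diagonal, conjTranspose_apply]
    rw [Finset.sum_comm]
    push_cast
    refine Finset.sum_congr rfl fun i _ => ?_
    rw [hc]
    push_cast
    rw [Finset.mul_sum]
    refine Finset.sum_congr rfl fun j _ => ?_
    rw [mul_right_comm, Complex.star_def, Complex.mul_conj, Complex.normSq_eq_norm_sq]
    push_cast
    ring
  have hcol : ∀ (X : Matrix (Fin d) (Fin d) ℂ) (i : Fin d),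
      frobSq (X.submatrix id fun _ : Fin 1 => i) = ∑ j, ‖X j i‖ ^ 2 := fun X i => by
    simp [frobSq]
  rw [e1]
  refine sum_mul_le_sum_sortDesc hl (schmidtNumbers_nonneg Φ)
    (fun i => Finset.sum_nonneg fun _ _ => sq_nonneg _) (fun i => ?_) ?_
  · have h1 : (R * U).submatrix id (fun _ : Fin 1 => i) =
        R * U.submatrix id fun _ : Fin 1 => i := by
      ext j k
      simp [mul_apply]
    have h2 : ∑ j, ‖U j i‖ ^ 2 = 1 := by
      have h3 := congrFun (congrFun hUU i) i
      rw [mul_apply, one_apply_eq] at h3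
      rw [← Complex.ofReal_inj, Complex.ofReal_one]
      refine Eq.trans ?_ h3
      push_cast
      refine Finset.sum_congr rfl fun j _ => ?_
      rw [conjTranspose_apply, mul_comm, Complex.star_def, Complex.mul_conj,
        Complex.normSq_eq_norm_sq]
      push_cast
      rfl
    rw [hc, ← h2]
    simp only
    rw [← hcol, ← hcol, h1]
    exact hR.frobSq_mul_le _
  · have h1 : ∑ i, c i = frobSq (R * U) := by
      rw [hc, frobSq, Finset.sum_comm]
    have h2 : (frobSq (R * U) : ℂ) = R.trace := by
      rw [ofReal_frobSq, conjTranspose_mul, ← Matrix.mul_assoc, Matrix.mul_assoc R, hUU',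
        Matrix.mul_one, hR.herm, hR.idem]
    rw [h1, ← Complex.ofReal_re (frobSq (R * U)), h2]
    exact hR.trace_le

/-- The partial sums of the Schmidt numbers do not decrease on average under LOCC. -/
theorem frobSq_proj_mul_le_of_converts {d a b N l : ℕ} {Ψ : Matrix (Fin a) (Fin b) ℂ}
    {p : Fin N → ℝ} {Φ : Fin N → Matrix (Fin d) (Fin d) ℂ} (h : Converts Ψ p Φ) (hl : l ≤ d)
    {R : Matrix (Fin a) (Fin a) ℂ} (hR : IsProjOfRankLE l R) :
    frobSq (R * Ψ) ≤ ∑ i ∈ Finset.range l, ∑ α, p α * sortDesc (schmidtNumbers (Φ α)) i := by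
  obtain ⟨-, hΦ', P, hP⟩ := h
  have hΦ : ∀ α, frobSq (Φ α) = 1 := hΦ'
  have := frobSq_proj_mul_le_output hΦ (fun α R hR => frobSq_proj_mul_le hl (Φ α) hR) P Ψ
    (fun α V hV => by
      have h1 := expectation_pureDensity V (Φ α)
      rw [hV] at h1
      rw [hP, expectation]
      simp only [Matrix.smul_apply, smul_eq_mul]
      have h2 : ∑ x : Fin d × Fin d, ∑ y : Fin d × Fin d,
          star (V x.1 x.2) * ((p α : ℂ) * pureDensity (Φ α) x y) * V y.1 y.2 =
          (p α : ℂ) * ∑ x : Fin d × Fin d, ∑ y : Fin d × Fin d,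
            star (V x.1 x.2) * pureDensity (Φ α) x y * V y.1 y.2 := by
        simp only [Finset.mul_sum]
        refine Finset.sum_congr rfl fun x _ => Finset.sum_congr rfl fun y _ => ?_
        ring
      rw [h2, Complex.re_ofReal_mul]
      rw [expectation] at h1
      rw [h1]
      simp) hR
  refine this.trans (le_of_eq ?_)
  rw [Finset.sum_comm]
  refine Finset.sum_congr rfl fun α _ => ?_
  rw [hP, trace_smul, trace_pureDensity, hΦ]
  simp [Finset.mul_sum, mul_comm]

lemma sum_prob_of_converts {d a b N : ℕ} {Ψ : Matrix (Fin a) (Fin b) ℂ}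
    {p : Fin N → ℝ} {Φ : Fin N → Matrix (Fin d) (Fin d) ℂ} (h : Converts Ψ p Φ) :
    ∑ α, p α = frobSq Ψ := by
  obtain ⟨-, hΦ, P, hP⟩ := h
  have hΦ' : ∀ α, frobSq (Φ α) = 1 := hΦ
  rw [← sum_trace_output P]
  refine Finset.sum_congr rfl fun α _ => ?_
  rw [hP, trace_smul, trace_pureDensity, hΦ']
  simp

lemma sum_sortDesc_schmidtNumbers {d : ℕ} (Φ : Matrix (Fin d) (Fin d) ℂ) :
    ∑ i ∈ Finset.range d, sortDesc (schmidtNumbers Φ) i = frobSq Φ := by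
  have h := (Matrix.isHermitian_mul_conjTranspose_self Φ).trace_eq_sum_eigenvalues
  rw [← ofReal_frobSq] at h
  rw [sum_sortDesc, ← Complex.ofReal_inj, h]
  push_cast
  rfl

/-! ### Majorization -/

/-- Abel summation. -/
lemma sum_mul_nonneg_of_partial_sums {d : ℕ} {a g : ℕ → ℝ}
    (ha : ∀ i j, i ≤ j → j < d → a j ≤ a i)
    (hg : ∀ l ≤ d, 0 ≤ ∑ i ∈ Finset.range l, g i) (hd : ∑ i ∈ Finset.range d, g i = 0) :
    0 ≤ ∑ i ∈ Finset.range d, a i * g i := by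
  have key : ∀ n, n < d → a n * ∑ i ∈ Finset.range (n + 1), g i ≤
      ∑ i ∈ Finset.range (n + 1), a i * g i := by
    intro n
    induction n with
    | zero => simp
    | succ n ih =>
      intro hn
      rw [Finset.sum_range_succ, Finset.sum_range_succ _ (n + 1)]
      have h1 := ih (by omega)
      have h2 := mul_le_mul_of_nonneg_right (ha n (n + 1) (by omega) hn) (hg (n + 1) (by omega))
      linarith
  cases d with
  | zero => simp
  | succ n =>
    have := key n (by omega)
    rwa [hd, mul_zero] at this

/-- A decreasing vector which is majorized by `v` lies in the permutohedron of `v`. -/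
theorem mem_convexHull_perm_of_majorized {d : ℕ} {u v : ℕ → ℝ}
    (hu : ∀ i j, i ≤ j → j < d → u j ≤ u i)
    (h : ∀ l ≤ d, ∑ i ∈ Finset.range l, u i ≤ ∑ i ∈ Finset.range l, v i)
    (hd : ∑ i ∈ Finset.range d, u i = ∑ i ∈ Finset.range d, v i) :
    (fun i : Fin d => u i) ∈
      convexHull ℝ (Set.range fun (σ : Equiv.Perm (Fin d)) (i : Fin d) => v (σ i)) := by
  by_contra hmem
  -- A functional `w` separating `u` from the hull would contradict `w·u ≤ w↓·u ≤ w↓·v = w·(v ∘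
  -- τ⁻¹)`: rearrangement, then Abel summation, then undoing the sort.
  obtain ⟨f, c, hf, hfc⟩ := geometric_hahn_banach_closed_point (convex_convexHull ℝ _)
    ((Set.finite_range fun (σ : Equiv.Perm (Fin d)) (i : Fin d) =>
      v (σ i)).isClosed_convexHull ℝ) hmem
  set w : Fin d → ℝ := fun i => f (Pi.single i 1) with hw
  have hfw : ∀ x : Fin d → ℝ, f x = ∑ i, w i * x i := fun x => by
    have := LinearMap.pi_apply_eq_sum_univ (f : (Fin d → ℝ) →ₗ[ℝ] ℝ) x
    simp only [ContinuousLinearMap.coe_coe, smul_eq_mul] at this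
    rw [this]
    refine Finset.sum_congr rfl fun i _ => ?_
    rw [mul_comm, hw]
    congr 2
    ext j
    simp [Pi.single_apply, eq_comm]
  set τ := Tuple.sort (fun i => -w i) with hτ
  have hw' : ∀ i : Fin d, w (τ i) = sortDesc w i := fun i => (sortDesc_coe w i).symm
  have h1 : ∑ i, w i * u i ≤ ∑ i : Fin d, sortDesc w i * u i := by
    have hmono : Monovary (fun i : Fin d => sortDesc w i) (fun i : Fin d => u i) := by
      intro i j hij
      have : ¬ i ≤ j := fun hle => not_le.2 hij (hu i j hle j.2)
      exact sortDesc_le_of_lt w (le_of_lt (not_le.1 this)) i.2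
    have := hmono.sum_comp_perm_mul_le_sum_mul (σ := τ⁻¹)
    simp only [← hw'] at this ⊢
    simpa using this
  have h2 : ∑ i : Fin d, sortDesc w i * u i ≤ ∑ i : Fin d, sortDesc w i * v i := by
    rw [Fin.sum_univ_eq_sum_range (fun i => sortDesc w i * u i),
      Fin.sum_univ_eq_sum_range (fun i => sortDesc w i * v i), ← sub_nonneg,
      ← Finset.sum_sub_distrib]
    simp only [← mul_sub]
    refine sum_mul_nonneg_of_partial_sums (fun i j hij hj => sortDesc_le_of_lt w hij hj)
      (fun l hl => ?_) ?_
    · rw [Finset.sum_sub_distrib, sub_nonneg]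
      exact h l hl
    · rw [Finset.sum_sub_distrib, hd, sub_self]
  have h3 : ∑ i : Fin d, sortDesc w i * v i = ∑ i, w i * v (τ⁻¹ i) := by
    rw [← Equiv.sum_comp τ fun i => w i * v (τ⁻¹ i)]
    simp [hw']
  have h4 := hf (fun i => v (τ⁻¹ i)) (subset_convexHull ℝ _ ⟨τ⁻¹, rfl⟩)
  rw [hfw] at h4 hfc
  linarith

/-! ### The purification function -/

/-- `purify` as a function on `ℕ`. -/
def purifySeq (d : ℕ) {m : ℕ} (x : Fin m → ℝ) (l : ℕ) : ℝ :=
  max (sortDesc x l) (purifyRest d x l / ((d : ℝ) - (l : ℝ)))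

/-- The purification function keeps the `j` largest entries and levels the rest. -/
theorem exists_purifySeq_eq {d m : ℕ} (hd : 1 ≤ d) (hdm : d ≤ m) {x : Fin m → ℝ}
    (hx : ∀ i, 0 ≤ x i) :
    ∃ (j : ℕ) (c : ℝ), j < d ∧ sortDesc x j ≤ c ∧ (∀ l < j, c ≤ sortDesc x l) ∧
      (∀ l < j, purifySeq d x l = sortDesc x l) ∧ (∀ l, j ≤ l → l < d → purifySeq d x l = c) ∧
      ∑ i ∈ Finset.range j, sortDesc x i + ((d : ℝ) - j) * c = ∑ i, x i := by
  classical
  have hpos : ∀ l < d, (0 : ℝ) < (d : ℝ) - l := fun l hl => by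
    have : (l : ℝ) < d := by exact_mod_cast hl
    linarith
  have hrest : ∀ l, (∀ i < l, purifyRest d x i / ((d : ℝ) - i) < sortDesc x i) →
      purifyRest d x l = ∑ i, x i - ∑ i ∈ Finset.range l, sortDesc x i := by
    intro l
    induction l with
    | zero => intro _; simp [purifyRest]
    | succ l ih =>
      intro h
      rw [purifyRest, max_eq_left (h l (by omega)).le, ih fun i hi => h i (by omega),
        Finset.sum_range_succ]
      ring
  -- Otherwise nothing is ever levelled before the last step, where the divisor is `1` and the
  -- remaining mass is at least `x↓_{d-1}`, because `d ≤ m`.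
  have hex : ∃ l, l < d ∧ sortDesc x l ≤ purifyRest d x l / ((d : ℝ) - l) := by
    by_contra! hno
    have h1 := hrest (d - 1) fun i hi => hno i (by omega)
    have h2 := hno (d - 1) (by omega)
    have h3 : (d : ℝ) - ((d - 1 : ℕ) : ℝ) = 1 := by
      rw [Nat.cast_sub hd]; push_cast; ring
    rw [h3, div_one, h1, ← sum_sortDesc x] at h2
    have h4 : ∑ i ∈ Finset.range d, sortDesc x i ≤ ∑ i ∈ Finset.range m, sortDesc x i :=
      Finset.sum_le_sum_of_subset_of_nonneg (Finset.range_mono hdm)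
        fun i _ _ => sortDesc_nonneg hx i
    obtain ⟨e, rfl⟩ : ∃ e, d = e + 1 := ⟨d - 1, by omega⟩
    rw [Finset.sum_range_succ] at h4
    simp only [Nat.add_sub_cancel] at h2
    linarith
  obtain ⟨hjd, hj⟩ := Nat.find_spec hex
  set j := Nat.find hex with hjdef
  have hmin : ∀ i < j, purifyRest d x i / ((d : ℝ) - i) < sortDesc x i := fun i hi => by
    have := Nat.find_min hex hi
    rw [not_and, not_le] at this
    exact this (hi.trans hjd)
  set c := purifyRest d x j / ((d : ℝ) - j) with hc
  have hcj : purifyRest d x j = ((d : ℝ) - j) * c := by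
    rw [hc, mul_div_cancel₀ _ (hpos j hjd).ne']
  -- Levelling persists: removing `c` from `(d - l) c` leaves the average `c`, and later entries do
  -- not exceed it.
  have hlevel : ∀ l, j ≤ l → l < d → purifyRest d x l = ((d : ℝ) - l) * c := by
    intro l hl
    induction l, hl using Nat.le_induction with
    | base => exact fun _ => hcj
    | succ l hl ih =>
      intro hld
      have h1 := ih (by omega)
      rw [purifyRest, h1, mul_div_cancel_left₀ _ (hpos l (by omega)).ne',
        max_eq_right ((sortDesc_antitone hx hl).trans hj)]
      push_cast
      ring
  refine ⟨j, c, hjd, hj, fun l hl => ?_, fun l hl => max_eq_left (hmin l hl).le,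
    fun l hl hld => ?_, ?_⟩
  -- At `i = j - 1` the entry exceeded the average, so removing it lowers the average of the rest to
  -- at most that entry.
  · obtain ⟨i, hi⟩ : ∃ i, j = i + 1 := ⟨j - 1, by omega⟩
    have hij : i < j := by omega
    have h1 := hmin i hij
    rw [div_lt_iff₀ (hpos i (by omega))] at h1
    have h2 : purifyRest d x j = purifyRest d x i - sortDesc x i := by
      rw [hi, purifyRest, max_eq_left (hmin i hij).le]
    have h3 : c ≤ sortDesc x i := by
      refine le_of_mul_le_mul_left ?_ (hpos j hjd)
      rw [← hcj, h2, hi]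
      push_cast
      linarith
    exact h3.trans (sortDesc_antitone hx (by omega))
  · rw [purifySeq, hlevel l hl hld, mul_div_cancel_left₀ _ (hpos l hld).ne']
    exact max_eq_right ((sortDesc_antitone hx hl).trans hj)
  · rw [← hcj, hrest j hmin]
    ring

/-- `𝒫 x` is the least decreasing vector in `ℝ^d` which majorizes `x`. -/
theorem purifySeq_majorized {d m : ℕ} (hd : 1 ≤ d) (hdm : d ≤ m) {x : Fin m → ℝ}
    (hx : ∀ i, 0 ≤ x i) {y : ℕ → ℝ} (hy : Antitone y)
    (h : ∀ l ≤ d, ∑ i ∈ Finset.range l, sortDesc x i ≤ ∑ i ∈ Finset.range l, y i)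
    (hsum : ∑ i ∈ Finset.range d, y i = ∑ i, x i) :
    (∀ i j, i ≤ j → j < d → purifySeq d x j ≤ purifySeq d x i) ∧
      (∀ l ≤ d, ∑ i ∈ Finset.range l, purifySeq d x i ≤ ∑ i ∈ Finset.range l, y i) ∧
      ∑ i ∈ Finset.range d, purifySeq d x i = ∑ i ∈ Finset.range d, y i := by
  obtain ⟨j, c, hjd, hjc, hcl, hlow, hhigh, htot⟩ := exists_purifySeq_eq hd hdm hx
  have hsmall : ∀ l ≤ j, ∑ i ∈ Finset.range l, purifySeq d x i =
      ∑ i ∈ Finset.range l, sortDesc x i := fun l hl =>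
    Finset.sum_congr rfl fun i hi => hlow i ((Finset.mem_range.1 hi).trans_le hl)
  have hlarge : ∀ l, j ≤ l → l ≤ d → ∑ i ∈ Finset.range l, purifySeq d x i =
      ∑ i ∈ Finset.range j, sortDesc x i + ((l : ℝ) - j) * c := by
    intro l hl hld
    rw [← Finset.sum_range_add_sum_Ico _ hl, hsmall j le_rfl,
      Finset.sum_congr rfl (s₁ := Finset.Ico j l) (g := fun _ => c)]
    · simp [Nat.cast_sub hl]
    · intro i hi
      rw [Finset.mem_Ico] at hi
      exact hhigh i hi.1 (by omega)
  have htot' : ∑ i ∈ Finset.range d, purifySeq d x i = ∑ i ∈ Finset.range d, y i := by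
    rw [hlarge d hjd.le le_rfl, htot, hsum]
  refine ⟨fun i k hik hk => ?_, fun l hl => ?_, htot'⟩
  · rcases lt_or_ge k j with hkj | hkj
    · rw [hlow k hkj, hlow i (by omega)]
      exact sortDesc_antitone hx hik
    · rw [hhigh k hkj hk]
      rcases lt_or_ge i j with hij | hij
      · rw [hlow i hij]
        exact hcl i hij
      · rw [hhigh i hij (by omega)]
  · rcases le_total l j with hlj | hlj
    · rw [hsmall l hlj]
      exact h l hl
    -- If `c ≤ y l`, the entries of `y` on `[j, l)` are at least `c`; otherwise those on `[l, d)`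
    -- are at most `c`, and tails are compared through the equal totals.
    · rcases le_total c (y l) with hcy | hcy
      · rw [hlarge l hlj hl, ← Finset.sum_range_add_sum_Ico _ hlj]
        have h1 : ((l : ℝ) - j) * c ≤ ∑ i ∈ Finset.Ico j l, y i := by
          have h2 := Finset.card_nsmul_le_sum (Finset.Ico j l) y c fun i hi =>
            hcy.trans (hy (Finset.mem_Ico.1 hi).2.le)
          simpa [Nat.cast_sub hlj] using h2
        linarith [h j hjd.le]
      · have h1 : ∑ i ∈ Finset.Ico l d, y i ≤ ((d : ℝ) - l) * c := by
          have h2 := Finset.sum_le_card_nsmul (Finset.Ico l d) y c fun i hi =>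
            (hy (Finset.mem_Ico.1 hi).1).trans hcy
          simpa [Nat.cast_sub hl] using h2
        have h3 := hlarge d hjd.le le_rfl
        rw [htot', ← Finset.sum_range_add_sum_Ico _ hl] at h3
        rw [hlarge l hlj hl]
        linarith

/-! ### The protocol -/

/-- A measurement of A whose outcomes are labelled by an arbitrary finite type. -/
def LOCC.aliceOf {d N a b c : ℕ} {ι : Type*} [Fintype ι] (M : ι → Matrix (Fin c) (Fin a) ℂ)
    (hM : ∑ i, (M i)ᴴ * M i = 1) (next : ι → LOCC d N c b) : LOCC d N a b :=
  .alice (fun _ => c) (fun i => M ((Fintype.equivFin ι).symm i))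
    (by rw [Equiv.sum_comp (Fintype.equivFin ι).symm fun i => (M i)ᴴ * M i, hM])
    fun i => next ((Fintype.equivFin ι).symm i)

/-- A measurement of B whose outcomes are labelled by an arbitrary finite type. -/
def LOCC.bobOf {d N a b c : ℕ} {ι : Type*} [Fintype ι] (M : ι → Matrix (Fin c) (Fin b) ℂ)
    (hM : ∑ i, (M i)ᴴ * M i = 1) (next : ι → LOCC d N a c) : LOCC d N a b :=
  .bob (fun _ => c) (fun i => M ((Fintype.equivFin ι).symm i))
    (by rw [Equiv.sum_comp (Fintype.equivFin ι).symm fun i => (M i)ᴴ * M i, hM])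
    fun i => next ((Fintype.equivFin ι).symm i)

lemma LOCC.output_aliceOf {d N a b c : ℕ} {ι : Type*} [Fintype ι]
    (M : ι → Matrix (Fin c) (Fin a) ℂ) (hM : ∑ i, (M i)ᴴ * M i = 1) (next : ι → LOCC d N c b)
    (Ψ : Matrix (Fin a) (Fin b) ℂ) (α : Fin N) :
    (LOCC.aliceOf M hM next).output Ψ α = ∑ i, (next i).output (M i * Ψ) α := by
  simp only [LOCC.aliceOf, LOCC.output]
  exact Equiv.sum_comp (Fintype.equivFin ι).symm fun i => (next i).output (M i * Ψ) α

lemma LOCC.output_bobOf {d N a b c : ℕ} {ι : Type*} [Fintype ι]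
    (M : ι → Matrix (Fin c) (Fin b) ℂ) (hM : ∑ i, (M i)ᴴ * M i = 1) (next : ι → LOCC d N a c)
    (Ψ : Matrix (Fin a) (Fin b) ℂ) (α : Fin N) :
    (LOCC.bobOf M hM next).output Ψ α = ∑ i, (next i).output (Ψ * (M i)ᵀ) α := by
  simp only [LOCC.bobOf, LOCC.output]
  exact Equiv.sum_comp (Fintype.equivFin ι).symm fun i => (next i).output (Ψ * (M i)ᵀ) α

lemma pureDensity_zero {a b : ℕ} : pureDensity (0 : Matrix (Fin a) (Fin b) ℂ) = 0 := by
  ext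
  simp [pureDensity]

lemma LOCC.output_zero {d N a b : ℕ} (P : LOCC d N a b) (α : Fin N) : P.output 0 α = 0 := by
  induction P with
  | done β => simp [LOCC.output, pureDensity_zero]
  | alice a' M hM next ih =>
    simp only [LOCC.output, Matrix.mul_zero]
    exact Finset.sum_eq_zero fun i _ => ih i
  | bob b' M hM next ih =>
    simp only [LOCC.output, Matrix.zero_mul]
    exact Finset.sum_eq_zero fun i _ => ih i

/-- The operator `∑_x f x |σ x⟩⟨x|` from `ℂ^m` to `ℂ^d`, the sum being over `σ x < d`. -/
def monomialOp (d : ℕ) {m : ℕ} (σ : Equiv.Perm (Fin m)) (f : Fin m → ℂ) :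
    Matrix (Fin d) (Fin m) ℂ :=
  Matrix.of fun j x => if (σ x : ℕ) = j then f x else 0

lemma conjTranspose_monomialOp_mul_self {d m : ℕ} (σ : Equiv.Perm (Fin m)) (f : Fin m → ℂ) :
    (monomialOp d σ f)ᴴ * monomialOp d σ f =
      diagonal fun x => if (σ x : ℕ) < d then ((‖f x‖ ^ 2 : ℝ) : ℂ) else 0 := by
  ext x y
  simp only [mul_apply, conjTranspose_apply, monomialOp, of_apply, diagonal_apply]
  by_cases hx : (σ x : ℕ) < d
  · rw [Finset.sum_eq_single ⟨σ x, hx⟩]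
    · by_cases hxy : x = y
      · subst hxy
        simp only [if_true, hx]
        rw [mul_comm, Complex.star_def, Complex.mul_conj, Complex.normSq_eq_norm_sq]
      · have : (σ y : ℕ) ≠ σ x := fun h => hxy (σ.injective (Fin.ext h)).symm
        simp [hxy, this]
    · intro j _ hj
      have : (σ x : ℕ) ≠ j := fun h => hj (Fin.ext h.symm)
      simp [this]
    · simp
  · have : ∀ j : Fin d, (σ x : ℕ) ≠ j := fun j h => hx (h ▸ j.2)
    simp [this, hx]

lemma monomialOp_mul_diagonal {d m : ℕ} (σ : Equiv.Perm (Fin m)) (f g : Fin m → ℂ) :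
    monomialOp d σ f * diagonal g = monomialOp d σ fun x => f x * g x := by
  ext j x
  simp only [mul_diagonal, monomialOp, of_apply]
  split_ifs <;> simp

/-- B repeats the relabelling `σ` already made by A, so the state becomes diagonal again and no
longer depends on `σ`. -/
lemma monomialOp_mul_transpose {d m : ℕ} (hdm : d ≤ m) (σ : Equiv.Perm (Fin m)) (h : Fin m → ℂ) :
    monomialOp d σ (fun x => h (σ x)) * (monomialOp d σ fun _ => 1)ᵀ =
      diagonal fun j => h (Fin.castLE hdm j) := by
  ext j k
  simp only [mul_apply, transpose_apply, monomialOp, of_apply, diagonal_apply]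
  rw [Equiv.sum_comp σ fun y =>
      (if (y : ℕ) = j then h y else 0) * if (y : ℕ) = k then (1 : ℂ) else 0,
    Finset.sum_eq_single (Fin.castLE hdm j)]
  · simp [Fin.ext_iff]
  · intro y _ hy
    have : (y : ℕ) ≠ j := fun h => hy (Fin.ext h)
    simp [this]
  · simp

lemma monomialOp_mul_transpose_single {d m : ℕ} (σ : Equiv.Perm (Fin m)) (f : Fin m → ℂ)
    (k : Fin d) (y : Fin m) (hy : d ≤ σ y) (c : ℂ) :
    monomialOp d σ f * (Matrix.single k y c)ᵀ = 0 := by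
  ext j i
  rw [mul_apply]
  refine Finset.sum_eq_zero fun x _ => ?_
  by_cases hx : x = y
  · subst hx
    have : (σ x : ℕ) ≠ j := by have := j.2; omega
    simp [monomialOp, this]
  · simp [Ne.symm hx]

/-- Supplies filler outcomes `|k⟩⟨y|` that complete a measurement on basis vectors where the state
has no weight. -/
lemma sum_single_conjTranspose_mul {d m : ℕ} (k : Fin d) (p : Fin m → Prop) [DecidablePred p] :
    ∑ y, (Matrix.single k y (if p y then (1 : ℂ) else 0))ᴴ *
        Matrix.single k y (if p y then (1 : ℂ) else 0) =
      diagonal fun y => if p y then (1 : ℂ) else 0 := by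
  ext x z
  rw [Matrix.sum_apply, diagonal_apply]
  simp only [conjTranspose_single, single_mul_single_same, Matrix.single_apply]
  by_cases hxz : x = z
  · subst hxz
    simp
  · rw [if_neg hxz]
    refine Finset.sum_eq_zero fun y _ => if_neg ?_
    rintro ⟨rfl, h⟩
    exact hxz h

/-- B applies `∑_x |σ x⟩⟨x|`, the sum being over `σ x < d`. -/
def relabelProtocol {d m : ℕ} (k : Fin d) (σ : Equiv.Perm (Fin m)) : LOCC d 1 d m :=
  LOCC.bobOf (ι := Option (Fin m))
    (fun o => o.elim (monomialOp d σ fun _ => 1)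
      fun y => Matrix.single k y (if d ≤ (σ y : ℕ) then (1 : ℂ) else 0))
    (by
      rw [Fintype.sum_option]
      simp only [Option.elim]
      rw [sum_single_conjTranspose_mul k fun y => d ≤ (σ y : ℕ),
        conjTranspose_monomialOp_mul_self, diagonal_add, ← diagonal_one]
      congr 1
      funext x
      by_cases hx : (σ x : ℕ) < d
      · simp [hx]
      · simp [hx, not_lt.1 hx])
    fun _ => .done 0

lemma output_relabelProtocol {d m : ℕ} (hdm : d ≤ m) (k : Fin d) (σ : Equiv.Perm (Fin m))
    (h : Fin m → ℂ) (α : Fin 1) :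
    (relabelProtocol k σ).output (monomialOp d σ fun x => h (σ x)) α =
      pureDensity (diagonal fun j => h (Fin.castLE hdm j)) := by
  rw [relabelProtocol, LOCC.output_bobOf, Fintype.sum_option, Finset.sum_eq_zero, add_zero]
  · simp only [Option.elim, monomialOp_mul_transpose hdm, LOCC.output]
    rw [if_pos (Subsingleton.elim _ _)]
  · intro y _
    simp only [Option.elim]
    split_ifs with hy
    · rw [monomialOp_mul_transpose_single σ _ k y hy, LOCC.output_zero]
    · simp [LOCC.output_zero]

/-- Deterministic conversion of `∑ √μₓ |xx⟩` when `μ` is an average of permutations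
of the target. -/
theorem converts_of_eq_sum_perm {d m : ℕ} (hd : 1 ≤ d) (hdm : d ≤ m) {ι : Type*} [Fintype ι]
    {μ χ : Fin m → ℝ} {w : ι → ℝ} {σ : ι → Equiv.Perm (Fin m)} (hχ : ∀ x, 0 ≤ χ x)
    (hχd : ∀ x : Fin m, d ≤ x → χ x = 0) (hχ1 : ∑ x, χ x = 1) (hw : ∀ i, 0 ≤ w i)
    (hw1 : ∑ i, w i = 1) (hμ : ∀ x, μ x = ∑ i, w i * χ (σ i x)) :
    Converts (diagonal fun x => ((Real.sqrt (μ x) : ℝ) : ℂ)) (fun _ : Fin 1 => (1 : ℝ))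
      fun _ => linkState fun j => χ (Fin.castLE hdm j) := by
  have hμ0 : ∀ x, 0 ≤ μ x := fun x => by
    rw [hμ]
    exact Finset.sum_nonneg fun i _ => mul_nonneg (hw i) (hχ _)
  -- Where `μ` vanishes all terms of its decomposition vanish, so the convention `a / 0 = 0` is
  -- harmless in the Kraus operators.
  have hμz : ∀ x, μ x = 0 → ∀ i, w i * χ (σ i x) = 0 := fun x hx i => by
    rw [hμ] at hx
    exact (Finset.sum_eq_zero_iff_of_nonneg fun i _ => mul_nonneg (hw i) (hχ _)).1 hx i
      (Finset.mem_univ i)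
  let k : Fin d := ⟨0, hd⟩
  -- The coefficients are chosen so that outcome `i` turns `√μₓ` into `√(w i) √χ(σ i x)`; the second
  -- family covers the zeros of `μ`.
  let K : ι ⊕ Fin m → Matrix (Fin d) (Fin m) ℂ := Sum.elim
    (fun i => monomialOp d (σ i) fun x => ((Real.sqrt (w i * χ (σ i x) / μ x) : ℝ) : ℂ))
    (fun y => Matrix.single k y (if μ y = 0 then (1 : ℂ) else 0))
  have hK : ∑ i, (K i)ᴴ * K i = 1 := by
    rw [Fintype.sum_sum_type]
    simp only [K, Sum.elim_inl, Sum.elim_inr]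
    rw [sum_single_conjTranspose_mul k fun y => μ y = 0]
    simp only [conjTranspose_monomialOp_mul_self]
    ext x y
    rw [Matrix.add_apply, Matrix.sum_apply]
    by_cases hxy : x = y
    · subst hxy
      simp only [diagonal_apply_eq, one_apply_eq]
      have : ∀ i, (if (σ i x : ℕ) < d then
          ((‖((Real.sqrt (w i * χ (σ i x) / μ x) : ℝ) : ℂ)‖ ^ 2 : ℝ) : ℂ) else 0) =
          ((w i * χ (σ i x) / μ x : ℝ) : ℂ) := by
        intro i
        split_ifs with h
        · rw [Complex.norm_real, Real.norm_eq_abs, sq_abs,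
            Real.sq_sqrt (div_nonneg (mul_nonneg (hw i) (hχ _)) (hμ0 x))]
        · simp [hχd _ (not_lt.1 h)]
      rw [Finset.sum_congr rfl fun i _ => this i, ← Complex.ofReal_sum, ← Finset.sum_div, ← hμ]
      by_cases hx : μ x = 0 <;> simp [hx]
    · simp [hxy]
  let next : ι ⊕ Fin m → LOCC d 1 d m := Sum.elim (fun i => relabelProtocol k (σ i))
    fun _ => relabelProtocol k 1
  refine ⟨fun _ => zero_le_one, fun _ => ?_, LOCC.aliceOf K hK next, fun α => ?_⟩
  · have h1 : frobSq (linkState fun j => χ (Fin.castLE hdm j)) = ∑ x, χ x := by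
      have h2 : frobSq (linkState fun j => χ (Fin.castLE hdm j)) =
          ∑ j, χ (Fin.castLE hdm j) := by
        refine Finset.sum_congr rfl fun i _ => ?_
        rw [Finset.sum_eq_single i]
        · simp [linkState, Real.sq_sqrt (hχ _)]
        · intro j _ hj
          simp [linkState, Ne.symm hj]
        · simp
      rw [h2]
      let u : ℕ → ℝ := fun l => if h : l < m then χ ⟨l, h⟩ else 0
      have hu : ∀ x : Fin m, χ x = u x := fun x => by simp [u]
      have h3 : ∑ j : Fin d, χ (Fin.castLE hdm j) = ∑ l ∈ Finset.range d, u l := by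
        rw [← Fin.sum_univ_eq_sum_range]
        exact Finset.sum_congr rfl fun j _ => hu _
      have h4 : ∑ x, χ x = ∑ l ∈ Finset.range m, u l := by
        rw [← Fin.sum_univ_eq_sum_range]
        exact Finset.sum_congr rfl fun j _ => hu _
      rw [h3, h4]
      refine Finset.sum_subset (Finset.range_mono hdm) fun l hl hl' => ?_
      rw [Finset.mem_range] at hl hl'
      simp only [u, hl, dif_pos]
      exact hχd _ (not_lt.1 hl')
    exact h1.trans hχ1
  · rw [LOCC.output_aliceOf, Fintype.sum_sum_type,
      Finset.sum_eq_zero (s := Finset.univ (α := Fin m)),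
      add_zero]
    · have h1 : ∀ i, (next (Sum.inl i)).output
          (K (Sum.inl i) * diagonal fun x => ((Real.sqrt (μ x) : ℝ) : ℂ)) α =
          (w i : ℂ) • pureDensity (linkState fun j => χ (Fin.castLE hdm j)) := by
        intro i
        simp only [next, K, Sum.elim_inl, monomialOp_mul_diagonal]
        have h2 : ∀ x, ((Real.sqrt (w i * χ (σ i x) / μ x) : ℝ) : ℂ) * ((Real.sqrt (μ x) : ℝ) : ℂ) =
            (fun y => ((Real.sqrt (w i) * Real.sqrt (χ y) : ℝ) : ℂ)) (σ i x) := by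
          intro x
          simp only
          rw [← Complex.ofReal_mul, ← Real.sqrt_mul' _ (hμ0 x), ← Real.sqrt_mul (hw i)]
          congr 2
          by_cases hx : μ x = 0
          · simp [hx, hμz x hx i]
          · rw [div_mul_cancel₀ _ hx]
        simp only [h2]
        rw [output_relabelProtocol hdm k (σ i)
          fun y => ((Real.sqrt (w i) * Real.sqrt (χ y) : ℝ) : ℂ)]
        ext x y
        have h3 : ((Real.sqrt (w i) : ℝ) : ℂ) * ((Real.sqrt (w i) : ℝ) : ℂ) = w i := by
          rw [← Complex.ofReal_mul, Real.mul_self_sqrt (hw i)]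
        have h4 : ∀ a b : Fin d, diagonal (fun j : Fin d =>
            ((Real.sqrt (w i) * Real.sqrt (χ (Fin.castLE hdm j)) : ℝ) : ℂ)) a b =
            ((Real.sqrt (w i) : ℝ) : ℂ) * linkState (fun j => χ (Fin.castLE hdm j)) a b := by
          intro a b
          simp only [linkState, diagonal_apply]
          split_ifs <;> simp
        simp only [pureDensity, of_apply, Matrix.smul_apply, smul_eq_mul, h4, star_mul', ← h3]
        rw [Complex.star_def, Complex.conj_ofReal]
        ring
      rw [Finset.sum_congr rfl fun i _ => h1 i, ← Finset.sum_smul, ← Complex.ofReal_sum, hw1]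
    · intro y _
      have : K (Sum.inr y) * diagonal (fun x => ((Real.sqrt (μ x) : ℝ) : ℂ)) = 0 := by
        ext j x
        simp only [K, Sum.elim_inr, mul_diagonal, Matrix.single_apply]
        by_cases hy : y = x
        · subst hy
          by_cases h0 : μ y = 0 <;> simp [h0]
        · simp [hy]
      rw [this, LOCC.output_zero]

/-- `x↓` is the image of `𝒫 x` under a doubly stochastic matrix. -/
theorem exists_doublyStochastic_purify {d m : ℕ} (hd : 1 ≤ d) (hdm : d ≤ m) {x : Fin m → ℝ}
    (hx : ∀ i, 0 ≤ x i) :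
    ∃ D ∈ doublyStochastic ℝ (Fin m), ∀ i : Fin m, sortDesc x i =
      ∑ y : Fin m, D i y * (if (y : ℕ) < d then purifySeq d x y else 0) := by
  obtain ⟨j, c, hjd, hjc, hcl, hlow, hhigh, htot⟩ := exists_purifySeq_eq hd hdm hx
  have hc0 : 0 ≤ c := (sortDesc_nonneg hx j).trans hjc
  have hle : ∀ i, j ≤ i → sortDesc x i ≤ c := fun i hi => (sortDesc_antitone hx hi).trans hjc
  have htail : ∑ i ∈ Finset.Ico j m, sortDesc x i = ((d : ℝ) - j) * c := by
    rw [← sum_sortDesc, ← Finset.sum_range_add_sum_Ico _ (hjd.le.trans hdm)] at htot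
    linarith
  -- If `x↓` already equals the padded `𝒫 x`, the identity matrix serves. Otherwise `c > 0` and `d <
  -- m`, so the divisions in `E` make sense.
  by_cases hdeg : ∀ i, j ≤ i → i < m → sortDesc x i = if i < d then c else 0
  · refine ⟨1, one_mem _, fun i => ?_⟩
    rw [Finset.sum_eq_single i (fun y _ hy => by simp [Ne.symm hy]) (by simp), one_apply_eq,
      one_mul]
    rcases lt_or_ge (i : ℕ) j with hi | hi
    · rw [if_pos (hi.trans hjd), hlow _ hi]
    · rw [hdeg i hi i.2]
      split_ifs with hid
      · rw [hhigh _ hi hid]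
      · rfl
  have hcpos : 0 < c := by
    refine hc0.lt_of_ne fun hc => hdeg fun i hi _ => ?_
    rw [← hc, ite_self]
    exact le_antisymm (hc ▸ hle i hi) (sortDesc_nonneg hx i)
  have hdm' : d < m := by
    refine hdm.lt_of_ne fun hdm' => hdeg fun i hi him => ?_
    subst hdm'
    rw [if_pos him]
    have h1 : ∑ i ∈ Finset.Ico j d, (c - sortDesc x i) = 0 := by
      rw [Finset.sum_sub_distrib, htail]
      simp [Nat.cast_sub hjd.le]
    have h2 := (Finset.sum_eq_zero_iff_of_nonneg fun i hi =>
      sub_nonneg.2 (hle i (Finset.mem_Ico.1 hi).1)).1 h1 i (Finset.mem_Ico.2 ⟨hi, him⟩)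
    linarith
  have hs : (0 : ℝ) < (d : ℝ) - j := by
    have : (j : ℝ) < d := by exact_mod_cast hjd
    linarith
  have ht : (0 : ℝ) < (m : ℝ) - d := by
    have : (d : ℝ) < m := by exact_mod_cast hdm'
    linarith
  -- Identity on the first `j` indices. A later row `i` puts mass `x↓ᵢ / c` evenly on the levelled
  -- columns, where `𝒫 x` is `c`, and the remaining mass evenly on the padding columns, where the
  -- vector is `0`. The columns sum to `1` by `htail`.
  let E : ℕ → ℕ → ℝ := fun i y =>
    if i < j then (if y = i then 1 else 0) else
      if y < j then 0 else if y < d then sortDesc x i / ((d - j) * c) else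
        (1 - sortDesc x i / c) / (m - d)
  have hsplit : ∀ f : ℕ → ℝ, ∑ y : Fin m, f y = ∑ y ∈ Finset.range j, f y +
      (∑ y ∈ Finset.Ico j d, f y + ∑ y ∈ Finset.Ico d m, f y) := fun f => by
    rw [Fin.sum_univ_eq_sum_range, Finset.sum_Ico_consecutive f hjd.le hdm,
      Finset.sum_range_add_sum_Ico _ (hjd.le.trans hdm)]
  have hrow : ∀ (i : ℕ) (f : ℕ → ℝ), j ≤ i → ∑ y : Fin m, E i y * f y =
      ∑ y ∈ Finset.Ico j d, sortDesc x i / ((d - j) * c) * f y +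
        ∑ y ∈ Finset.Ico d m, (1 - sortDesc x i / c) / (m - d) * f y := by
    intro i f hi
    rw [hsplit fun y => E i y * f y, Finset.sum_eq_zero, zero_add]
    · congr 1
      · refine Finset.sum_congr rfl fun y hy => ?_
        rw [Finset.mem_Ico] at hy
        simp [E, hi.not_gt, hy.1.not_gt, hy.2]
      · refine Finset.sum_congr rfl fun y hy => ?_
        rw [Finset.mem_Ico] at hy
        simp [E, hi.not_gt, (hjd.le.trans hy.1).not_gt, hy.1.not_gt]
    · intro y hy
      simp [E, hi.not_gt, Finset.mem_range.1 hy]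
  have hrow' : ∀ (i : Fin m) (f : ℕ → ℝ), (i : ℕ) < j → ∑ y : Fin m, E i y * f y = f i := by
    intro i f hi
    rw [Finset.sum_eq_single i]
    · simp [E, hi]
    · intro y _ hy
      simp [E, hi, Fin.val_ne_of_ne hy]
    · simp
  refine ⟨Matrix.of fun i y => E i y, mem_doublyStochastic_iff_sum.2 ⟨?_, ?_, ?_⟩, ?_⟩
  · intro i y
    simp only [of_apply, E]
    have := sortDesc_nonneg hx i
    split_ifs with h1 h2 h3 h4
    · exact zero_le_one
    · exact le_rfl
    · exact le_rfl
    · positivity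
    · refine div_nonneg (sub_nonneg.2 ((div_le_one hcpos).2 (hle i (not_lt.1 h1)))) ht.le
  · intro i
    simp only [of_apply]
    rcases lt_or_ge (i : ℕ) j with hi | hi
    · simpa using hrow' i (fun _ => 1) hi
    · have := hrow i (fun _ => 1) hi
      simp only [mul_one, Finset.sum_const, Nat.card_Ico, nsmul_eq_mul, Nat.cast_sub hjd.le,
        Nat.cast_sub hdm] at this
      rw [this]
      field_simp
      ring
  · intro y
    simp only [of_apply]
    rw [Fin.sum_univ_eq_sum_range (fun i => E i y),
      ← Finset.sum_range_add_sum_Ico _ (hjd.le.trans hdm)]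
    rcases lt_or_ge (y : ℕ) j with hy | hy
    · rw [Finset.sum_eq_zero (s := Finset.Ico j m), add_zero, Finset.sum_eq_single (y : ℕ)]
      · simp [E, hy]
      · intro i hi hiy
        simp [E, Finset.mem_range.1 hi, Ne.symm hiy]
      · intro h
        exact absurd (Finset.mem_range.2 hy) h
      · intro i hi
        simp [E, hy, (Finset.mem_Ico.1 hi).1.not_gt]
    · rw [Finset.sum_eq_zero (s := Finset.range j), zero_add]
      · by_cases hyd : (y : ℕ) < d
        · rw [Finset.sum_congr rfl (g := fun i => sortDesc x i / ((d - j) * c)), ← Finset.sum_div,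
            htail, div_self (by positivity)]
          intro i hi
          simp [E, hy.not_gt, hyd, (Finset.mem_Ico.1 hi).1.not_gt]
        · rw [Finset.sum_congr rfl (g := fun i => (1 - sortDesc x i / c) / (m - d)),
            ← Finset.sum_div, Finset.sum_sub_distrib, ← Finset.sum_div, htail]
          · simp only [Finset.sum_const, Nat.card_Ico, nsmul_eq_mul,
              Nat.cast_sub (hjd.le.trans hdm)]
            field_simp
            ring
          · intro i hi
            simp [E, hy.not_gt, hyd, (Finset.mem_Ico.1 hi).1.not_gt]
      · intro i hi
        have hij := Finset.mem_range.1 hi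
        simp [E, hij, (hij.trans_le hy).ne']
  · intro i
    simp only [of_apply]
    rcases lt_or_ge (i : ℕ) j with hi | hi
    · rw [hrow' i (fun y => if y < d then purifySeq d x y else 0) hi, if_pos (hi.trans hjd),
        hlow _ hi]
    · rw [hrow i (fun y => if y < d then purifySeq d x y else 0) hi,
        Finset.sum_eq_zero (s := Finset.Ico d m), add_zero,
        Finset.sum_congr rfl (g := fun _ => sortDesc x i / ((d - j) * c) * c)]
      · simp only [Finset.sum_const, Nat.card_Ico, nsmul_eq_mul, Nat.cast_sub hjd.le]
        field_simp
      · intro y hy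
        rw [Finset.mem_Ico] at hy
        rw [if_pos hy.2, hhigh y hy.1 hy.2]
      · intro y hy
        rw [if_neg (Finset.mem_Ico.1 hy).1.not_gt, mul_zero]

lemma purifySeq_nonneg {d m : ℕ} {x : Fin m → ℝ} (hx : ∀ i, 0 ≤ x i) (l : ℕ) :
    0 ≤ purifySeq d x l :=
  (sortDesc_nonneg hx l).trans (le_max_left _ _)

lemma sum_purifySeq {d m : ℕ} (hd : 1 ≤ d) (hdm : d ≤ m) {x : Fin m → ℝ} (hx : ∀ i, 0 ≤ x i) :
    ∑ l ∈ Finset.range d, purifySeq d x l = ∑ i, x i := by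
  obtain ⟨j, c, hjd, -, -, hlow, hhigh, htot⟩ := exists_purifySeq_eq hd hdm hx
  rw [← Finset.sum_range_add_sum_Ico _ hjd.le, ← htot,
    Finset.sum_congr rfl fun i hi => hlow i (Finset.mem_range.1 hi),
    Finset.sum_congr rfl fun i hi =>
      hhigh i (Finset.mem_Ico.1 hi).1 (Finset.mem_Ico.1 hi).2]
  simp [Nat.cast_sub hjd.le]

/-- Deterministic purification of a diagonal state. -/
theorem converts_purify {d m : ℕ} (hd : 1 ≤ d) (hdm : d ≤ m) {μ : Fin m → ℝ} (hμ : ∀ i, 0 ≤ μ i)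
    (hμ1 : ∑ i, μ i = 1) :
    Converts (diagonal fun x => ((Real.sqrt (μ x) : ℝ) : ℂ)) (fun _ : Fin 1 => (1 : ℝ))
      fun _ => linkState (purify d μ) := by
  obtain ⟨D, hD, hDμ⟩ := exists_doublyStochastic_purify hd hdm hμ
  obtain ⟨w, hw, hw1, rfl⟩ := exists_eq_sum_perm_of_mem_doublyStochastic hD
  set τ := Tuple.sort (fun i => -μ i) with hτ
  set χ : Fin m → ℝ := fun y => if (y : ℕ) < d then purifySeq d μ y else 0 with hχ
  -- Birkhoff's permutations act on sorted indices; composing with `τ⁻¹` returns to the original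
  -- order.
  have key := converts_of_eq_sum_perm hd hdm (μ := μ) (χ := χ) (w := w)
    (σ := fun σ => σ * τ⁻¹) (fun x => ?_) (fun x hx => ?_) ?_ hw hw1 fun x => ?_
  · convert key using 3 with _
    funext j
    simp [hχ, purify, purifySeq]
  · simp only [hχ]
    split_ifs
    · exact purifySeq_nonneg hμ _
    · exact le_rfl
  · simp [hχ, not_lt.2 hx]
  · rw [← hμ1, ← sum_purifySeq hd hdm hμ, ← sum_range_ite_lt hdm]
  · have h1 := hDμ (τ⁻¹ x)
    rw [sortDesc_coe] at h1
    have h2 : μ (τ (τ⁻¹ x)) = μ x := by simp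
    rw [← h2, h1]
    simp only [Matrix.sum_apply, Finset.sum_mul]
    rw [Finset.sum_comm]
    refine Finset.sum_congr rfl fun σ _ => ?_
    rw [Finset.sum_eq_single (σ (τ⁻¹ x))]
    · simp [hχ, Equiv.Perm.permMatrix, PEquiv.toMatrix_apply]
    · intro y _ hy
      simp [Equiv.Perm.permMatrix, PEquiv.toMatrix_apply]
      exact fun _ h => absurd h.symm hy
    · simp

/-! ### Optimality -/

/-- The test projection is the coordinate projection onto the `l` largest entries of `μ`. -/
lemma sum_range_sortDesc_le_of_converts {d m N l : ℕ} {μ : Fin m → ℝ} (hμ : ∀ i, 0 ≤ μ i)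
    {p : Fin N → ℝ} {Φ : Fin N → Matrix (Fin d) (Fin d) ℂ}
    (h : Converts (diagonal fun x => ((Real.sqrt (μ x) : ℝ) : ℂ)) p Φ) (hl : l ≤ d)
    (hlm : l ≤ m) :
    ∑ i ∈ Finset.range l, sortDesc μ i ≤
      ∑ i ∈ Finset.range l, ∑ α, p α * sortDesc (schmidtNumbers (Φ α)) i := by
  set τ := Tuple.sort (fun i => -μ i) with hτ
  set v : Fin m → ℂ := fun x => if ((τ⁻¹ x : Fin m) : ℕ) < l then 1 else 0 with hv
  have hcard : ∑ x : Fin m, (if ((τ⁻¹ x : Fin m) : ℕ) < l then (1 : ℝ) else 0) = l := by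
    rw [Equiv.sum_comp τ⁻¹ fun x : Fin m => if (x : ℕ) < l then (1 : ℝ) else 0,
      sum_range_ite_lt hlm fun _ => 1]
    simp
  have hR : IsProjOfRankLE l (diagonal v) := by
    refine ⟨?_, ?_, ?_, ?_⟩
    · rw [diagonal_conjTranspose]
      congr 1
      ext x
      simp [hv, apply_ite]
    · rw [diagonal_mul_diagonal]
      congr 1
      ext x
      simp [hv]
    · rw [rank_diagonal, Fintype.card_subtype, ← Nat.cast_le (α := ℝ), ← hcard]
      simp [hv]
    · rw [trace_diagonal, ← hcard, Complex.re_sum]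
      refine (Finset.sum_congr rfl fun x _ => ?_).le
      simp only [hv]
      split_ifs <;> simp
  refine le_trans (ge_of_eq ?_) (frobSq_proj_mul_le_of_converts h hl hR)
  rw [diagonal_mul_diagonal, ← sum_range_ite_lt hlm]
  refine (Equiv.sum_comp τ fun i => ∑ j,
    ‖diagonal (fun x => v x * ((Real.sqrt (μ x) : ℝ) : ℂ)) i j‖ ^ 2).symm.trans ?_
  refine Finset.sum_congr rfl fun i _ => ?_
  rw [Finset.sum_eq_single (τ i)]
  · rw [diagonal_apply_eq, sortDesc_coe]
    have hτi : τ⁻¹ (τ i) = i := τ.symm_apply_apply i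
    simp only [hv, hτi]
    split_ifs
    · simp [Real.sq_sqrt (hμ _), hτ]
    · simp
  · intro y _ hy
    simp [Ne.symm hy]
  · simp

lemma concurrence_sortDesc {d : ℕ} (k : ℕ) (x : Fin d → ℝ) :
    concurrence k (fun i : Fin d => sortDesc x i) = concurrence k x := by
  rw [← concurrence_comp_perm k x (Tuple.sort fun i => -x i)]
  congr 1
  funext i
  exact sortDesc_coe x i

/-- The average concurrence of every ensemble obtained from a diagonal state is bounded by the
concurrence of its purification. -/
theorem averageConcurrence_le {d m N k : ℕ} (hk : 1 ≤ k) (hkd : k ≤ d) (hdm : d ≤ m)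
    {μ : Fin m → ℝ} (hμ : ∀ i, 0 ≤ μ i) (hμ1 : ∑ i, μ i = 1) {p : Fin N → ℝ}
    {Φ : Fin N → Matrix (Fin d) (Fin d) ℂ}
    (h : Converts (diagonal fun x => ((Real.sqrt (μ x) : ℝ) : ℂ)) p Φ) :
    averageConcurrence k p Φ ≤ concurrence k (purify d μ) := by
  have hp : ∀ α, 0 ≤ p α := h.1
  have hΦ : ∀ α, frobSq (Φ α) = 1 := h.2.1
  have hp1 : ∑ α, p α = 1 := by
    rw [sum_prob_of_converts h, ← hμ1]
    refine Finset.sum_congr rfl fun x _ => ?_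
    rw [Finset.sum_eq_single x]
    · simp [Real.sq_sqrt (hμ x)]
    · intro y _ hy
      simp [Ne.symm hy]
    · simp
  set y : ℕ → ℝ := fun i => ∑ α, p α * sortDesc (schmidtNumbers (Φ α)) i with hy
  have hy0 : ∀ i, 0 ≤ y i := fun i => Finset.sum_nonneg fun α _ =>
    mul_nonneg (hp α) (sortDesc_nonneg (schmidtNumbers_nonneg _) i)
  have hyanti : Antitone y := fun i j hij => Finset.sum_le_sum fun α _ =>
    mul_le_mul_of_nonneg_left (sortDesc_antitone (schmidtNumbers_nonneg _) hij) (hp α)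
  have hysum : ∑ i ∈ Finset.range d, y i = ∑ i, μ i := by
    simp only [hy]
    rw [Finset.sum_comm, hμ1, ← hp1]
    refine Finset.sum_congr rfl fun α _ => ?_
    rw [← Finset.mul_sum, sum_sortDesc_schmidtNumbers, hΦ, mul_one]
  obtain ⟨h1, h2, h3⟩ := purifySeq_majorized (hk.trans hkd) hdm hμ hyanti
    (fun l hl => sum_range_sortDesc_le_of_converts hμ h hl (hl.trans hdm)) hysum
  have hmem := mem_convexHull_perm_of_majorized h1 h2 h3
  have hconc := concaveOn_concurrence (d := d) hk hkd
  have hsub : Set.range (fun (σ : Equiv.Perm (Fin d)) (i : Fin d) => y (σ i)) ⊆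
      {x : Fin d → ℝ | ∀ i, 0 ≤ x i} := by
    rintro _ ⟨σ, rfl⟩ i
    exact hy0 _
  -- On a convex hull a concave function is bounded below by its value at some generator, and by
  -- symmetry all generators have the value `C_k y`.
  obtain ⟨_, ⟨σ, rfl⟩, hσ⟩ := hconc.exists_le_of_mem_convexHull hsub hmem
  have h4 : concurrence k (fun i : Fin d => y (σ i)) = concurrence k (fun i : Fin d => y i) :=
    concurrence_comp_perm k (fun i : Fin d => y i) σ
  -- Jensen, applied to the sorted Schmidt vectors.
  have h5 := hconc.le_map_sum (t := Finset.univ) (w := p)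
    (p := fun α (i : Fin d) => sortDesc (schmidtNumbers (Φ α)) i) (fun α _ => hp α) hp1
    fun α _ i => sortDesc_nonneg (schmidtNumbers_nonneg _) i
  have h6 : ∑ α, p α • (fun i : Fin d => sortDesc (schmidtNumbers (Φ α)) i) =
      fun i : Fin d => y i := by
    funext i
    simp [hy]
  rw [h6] at h5
  simp only [concurrence_sortDesc, smul_eq_mul] at h5
  exact (h5.trans h4.ge).trans hσ

/-- The eigenvalues come in an unspecified order, so they are compared with `x` as multisets,
through the roots of the characteristic polynomial. -/
lemma concurrence_schmidtNumbers_linkState {d : ℕ} (k : ℕ) {x : Fin d → ℝ} (hx : ∀ i, 0 ≤ x i) :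
    concurrence k (schmidtNumbers (linkState x)) = concurrence k x := by
  refine concurrence_congr k ?_
  have h1 := (Matrix.isHermitian_mul_conjTranspose_self
    (linkState x)).roots_charpoly_eq_eigenvalues
  have h2 : linkState x * (linkState x)ᴴ = diagonal fun i => (x i : ℂ) := by
    rw [linkState, diagonal_conjTranspose, diagonal_mul_diagonal]
    congr 1
    funext i
    rw [Pi.star_apply, Complex.star_def, Complex.conj_ofReal, ← Complex.ofReal_mul,
      Real.mul_self_sqrt (hx i)]
  have h3 : (linkState x * (linkState x)ᴴ).charpoly.roots =
      Finset.univ.val.map fun i => (x i : ℂ) := by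
    rw [h2, charpoly_diagonal, Polynomial.roots_prod]
    · simp
    · simp [Finset.prod_ne_zero_iff, Polynomial.X_sub_C_ne_zero]
  rw [h3] at h1
  refine Multiset.map_injective Complex.ofReal_injective ?_
  rw [Multiset.map_map, Multiset.map_map]
  exact h1.symm

/-! ### Reduction of the parallel links to one diagonal state -/

lemma parallelState_eq_diagonal {d n : ℕ} {lam : Fin n → Fin d → ℝ} (h : ∀ i j, 0 ≤ lam i j) :
    parallelState lam = diagonal fun x => ((Real.sqrt (kronVec lam x) : ℝ) : ℂ) := by
  ext x y
  simp only [parallelState, of_apply, linkState]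
  by_cases hxy : x = y
  · subst hxy
    simp only [diagonal_apply_eq, kronVec]
    rw [Real.sqrt_prod _ fun i _ => h i _]
    push_cast
    rfl
  · rw [diagonal_apply_ne _ hxy]
    obtain ⟨i, hi⟩ := Function.ne_iff.1 fun e => hxy (finFunctionFinEquiv.symm.injective e)
    exact Finset.prod_eq_zero (Finset.mem_univ i) (diagonal_apply_ne _ hi)

lemma kronVec_nonneg {d n : ℕ} {lam : Fin n → Fin d → ℝ} (h : ∀ i j, 0 ≤ lam i j)
    (x : Fin (d ^ n)) : 0 ≤ kronVec lam x :=
  Finset.prod_nonneg fun i _ => h i _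

lemma sum_kronVec {d n : ℕ} {lam : Fin n → Fin d → ℝ} (h : ∀ i, ∑ j, lam i j = 1) :
    ∑ x, kronVec lam x = 1 := by
  unfold kronVec
  rw [Equiv.sum_comp finFunctionFinEquiv.symm fun f : Fin n → Fin d => ∏ i, lam i (f i),
    ← Fintype.prod_sum]
  simp [h]

end QNet

end

theorem mainTheorem5 (d n : ℕ) (hd : 1 ≤ d) (hn : 1 ≤ n) (lam : Fin n → Fin d → ℝ)
    (hlam_nonneg : ∀ i j, 0 ≤ lam i j) (hlam_sum : ∀ i, ∑ j, lam i j = 1) :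
    QNet.Converts (QNet.parallelState lam) (fun _ : Fin 1 => (1 : ℝ))
        (fun _ => QNet.linkState (QNet.purify d (QNet.kronVec lam))) ∧
      ∀ k : ℕ, 1 ≤ k → k ≤ d →
        IsGreatest
          {c : ℝ | ∃ (N : ℕ) (p : Fin N → ℝ) (Φ : Fin N → Matrix (Fin d) (Fin d) ℂ),
            QNet.Converts (QNet.parallelState lam) p Φ ∧ c = QNet.averageConcurrence k p Φ}
          (QNet.concurrence k (QNet.purify d (QNet.kronVec lam))) := by
  have hdm : d ≤ d ^ n := Nat.le_self_pow (by omega) d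
  have hμ := QNet.kronVec_nonneg hlam_nonneg
  have hμ1 := QNet.sum_kronVec hlam_sum
  rw [QNet.parallelState_eq_diagonal hlam_nonneg]
  have hconv := QNet.converts_purify hd hdm hμ hμ1
  -- The maximum is attained by the one-outcome ensemble of the deterministic conversion.
  refine ⟨hconv, fun k hk hkd => ⟨⟨1, _, _, hconv, ?_⟩, ?_⟩⟩
  · simp only [QNet.averageConcurrence, Finset.univ_unique, Finset.sum_singleton, one_mul]
    exact (QNet.concurrence_schmidtNumbers_linkState k fun l => QNet.purifySeq_nonneg hμ l).symm
  · rintro _ ⟨N, p, Φ, h, rfl⟩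
    exact QNet.averageConcurrence_le hk hkd hdm hμ hμ1 h
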